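/- Let $N\ge 2$. A formal real hypersurface $M\subset\mathbb{C}^N$ is given by a power series $r\in\mathbb{C}[[Z,\zeta]]$, $Z,\zeta\in\mathbb{C}^N$, with $\bar r(\zeta,Z)=r(Z,\zeta)$, $r(0)=0$ and $\partial_Z r(0)\neq 0$, where a bar over a power series denotes conjugation of its coefficients; put $\mathcal I(M)=(r)$ and $T_0^{1,0}M=\ker \partial_Z r(0)\subset\mathbb{C}^N$. *Normal coordinates* for $M$ are given by an invertible formal change of coordinates $Z=Z(z,w)$ fixing the origin, $(z,w)\in\mathbb{C}^{N-1}\times\mathbb{C}$, such that in the coordinates $(Z,\zeta)=(Z(z,w),\bar Z(\chi,\tau))$ the ideal $\mathcal I(M)$ is generated by $w-Q(z,\chi,\tau)$ for some $Q\in\mathbb{C}[[z,\chi,\tau]]$ with $Q(0,\chi,\tau)=Q(z,0,\tau)=\tau$. The *generic rank* of a tuple of power series is the rank of its Jacobian matrix over the ring of formal power series. The hypersurface $M$ *belongs to the class* $\mathcal C$ if, in normal coordinates, for all large enough $k$ the formal map $\chi\mapsto (Q_{z^\alpha}(0,\chi,0))_{|\alpha|\le k}$ has generic rank $N-1$. Let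 $M,M'\subset\mathbb{C}^N$ be formal real hypersurfaces. A formal holomorphic map $H:(\mathbb{C}^N,0)\to(\mathbb{C}^N,0)$ *sends $M$ into $M'$* if $h(H(Z),\bar H(\zeta))\in\mathcal I(M)$ for every $h\in\mathcal I(M')$. In normal coordinates for $M$ and $M'$, write $H=(F,G)$ with $F$ having $N-1$ components and $G$ one. The map $H$ is *transversally nonflat* if $G\not\equiv 0$; it is *not totally degenerate* if the matrix $\frac{\partial F}{\partial z}(z,0)$ has rank $N-1$ over $\mathbb{C}[[z]]$; and it is *CR-transversal* if $T_0^{1,0}M'+dH(T_0\mathbb{C}^N)=T_0\mathbb{C}^N$, where $dH$ is the differential of $H$ at $0$. (Membership in $\mathcal C$, transversal nonflatness and total degeneracy do not depend on the choice of normal coordinates.) **Theorem.** Let $N\ge 2$ and let $M,M'\subset\mathbb{C}^N$ be formal real hypersurfaces, with $M$ belonging to the class $\mathcal C$. Then every formal holomorphic map $H:(\mathbb{C}^N,0)\to(\mathbb{C}^N,0)$ sending $M$ into $M'$ which is transversally nonflat is not totally degenerate, and it is CR-transversal. -/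

import Mathlib

noncomputable section

namespace FormalCR

open MvPowerSeries

/-! ### Formal maps -/

/-- A formal holomorphic map `(ℂ^k, 0) → (ℂ^l, 0)`: an `l`-tuple of formal power series in `k`
variables without constant terms. -/
structure FormalMap (k l : ℕ) where
  toFun : Fin l → MvPowerSeries (Fin k) ℂ
  map_zero : ∀ j, constantCoeff (toFun j) = 0

namespace FormalMap

theorem hasSubst {k l : ℕ} (F : FormalMap k l) : HasSubst F.toFun :=
  hasSubst_of_constantCoeff_zero F.map_zero

/-- The identity map. -/
def id (k : ℕ) : FormalMap k k where
  toFun := fun j => X j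
  map_zero := fun j => constantCoeff_X j

/-- The composition `G ∘ F`. -/
def comp {k l m : ℕ} (G : FormalMap l m) (F : FormalMap k l) : FormalMap k m where
  toFun := fun j => subst F.toFun (G.toFun j)
  map_zero := fun j => constantCoeff_subst_eq_zero F.hasSubst F.map_zero (G.map_zero j)

/-- The formal map `(Z, ζ) ↦ (F(Z), F̄(ζ))`, where `F̄` is obtained from `F` by conjugating all
coefficients. The variables `Z` are indexed by `Sum.inl` and the variables `ζ` by `Sum.inr`. -/
def complexify {k l : ℕ} (F : FormalMap k l) :
    Fin l ⊕ Fin l → MvPowerSeries (Fin k ⊕ Fin k) ℂ :=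
  Sum.elim
    (fun j => rename Sum.inl (F.toFun j))
    (fun j => rename Sum.inr (MvPowerSeries.map (starRingEnd ℂ) (F.toFun j)))

/-- The matrix at the origin of the differential `dF` of a formal map. -/
def differentialMatrix {k l : ℕ} (F : FormalMap k l) : Matrix (Fin l) (Fin k) ℂ :=
  Matrix.of fun i j => constantCoeff (pderiv ℂ j (F.toFun i))

end FormalMap

/-- The generic rank of a tuple of formal power series in finitely many variables: the rank, over
the ring of formal power series, of its Jacobian matrix. -/
def genericRank {ι : Type} {k : ℕ} (F : ι → MvPowerSeries (Fin k) ℂ) : ℕ :=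
  (Matrix.of fun (i : ι) (j : Fin k) => pderiv ℂ j (F i)).rank

/-! ### Formal real hypersurfaces -/

/-- The involution `(σ f)(Z, ζ) = f̄(ζ, Z)` of `ℂ⟦Z, ζ⟧`. -/
def involution {N : ℕ} (f : MvPowerSeries (Fin N ⊕ Fin N) ℂ) :
    MvPowerSeries (Fin N ⊕ Fin N) ℂ :=
  rename Sum.swap (MvPowerSeries.map (starRingEnd ℂ) f)

/-- A formal real hypersurface through the origin of `ℂ^N`, given by a defining power series `r`
in `(Z, ζ)`. -/
structure FormalRealHypersurface (N : ℕ) where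
  r : MvPowerSeries (Fin N ⊕ Fin N) ℂ
  invariant : involution r = r
  zero_mem : constantCoeff r = 0
  gradient_ne_zero : ∃ j : Fin N, constantCoeff (pderiv ℂ (Sum.inl j) r) ≠ 0

namespace FormalRealHypersurface

/-- The ideal of `M`, generated by its defining power series. -/
def ideal {N : ℕ} (M : FormalRealHypersurface N) : Ideal (MvPowerSeries (Fin N ⊕ Fin N) ℂ) :=
  Ideal.span {M.r}

/-- The space `T₀^{1,0} M`: the kernel of the complex linear form `∂_Z r(0)`. -/
def holTangentSpace {N : ℕ} (M : FormalRealHypersurface N) : Submodule ℂ (Fin N → ℂ) :=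
  LinearMap.ker
    (∑ j : Fin N, constantCoeff (pderiv ℂ (Sum.inl j) M.r) •
      (LinearMap.proj j : (Fin N → ℂ) →ₗ[ℂ] ℂ))

/-- A choice of formal normal coordinates for `M ⊂ ℂ^{n+1}`: a formal change of coordinates
`Z = Z(z, w)`, where `w` is the last coordinate, and a power series `Q(z, χ, τ)` with
`Q(0, χ, τ) = Q(z, 0, τ) = τ` such that in the coordinates `(z, w, χ, τ)` the hypersurface is
defined by `w - Q(z, χ, τ)`.

In `Q` the variables `z` are indexed by `Sum.inl` and `(χ, τ)` by `Sum.inr`, `τ` being the last of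
them. -/
structure NormalCoordinates {n : ℕ} (M : FormalRealHypersurface (n + 1)) where
  chart : FormalMap (n + 1) (n + 1)
  chartInv : FormalMap (n + 1) (n + 1)
  chart_comp_chartInv : chart.comp chartInv = FormalMap.id (n + 1)
  chartInv_comp_chart : chartInv.comp chart = FormalMap.id (n + 1)
  Q : MvPowerSeries (Fin n ⊕ Fin (n + 1)) ℂ
  normal_z : subst
      (Sum.elim (fun _ => 0) (fun j => X j) :
        Fin n ⊕ Fin (n + 1) → MvPowerSeries (Fin (n + 1)) ℂ) Q = X (Fin.last n)
  normal_chi : subst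
      (Sum.elim (fun i => X i.castSucc) (Pi.single (Fin.last n) (X (Fin.last n))) :
        Fin n ⊕ Fin (n + 1) → MvPowerSeries (Fin (n + 1)) ℂ) Q = X (Fin.last n)
  defining : Ideal.span {subst chart.complexify M.r} =
    Ideal.span {X (Sum.inl (Fin.last n)) - rename (Sum.map Fin.castSucc _root_.id) Q}

/-- The power series `Q_{z^α}(0, χ, 0)` in `χ`: its coefficient at `χ^β` is `α!` times the
coefficient of `z^α χ^β` in `Q`. -/
def NormalCoordinates.QDeriv {n : ℕ} {M : FormalRealHypersurface (n + 1)}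
    (c : NormalCoordinates M) (α : Fin n →₀ ℕ) : MvPowerSeries (Fin n) ℂ :=
  fun β => ((∏ i, (α i).factorial : ℕ) : ℂ) *
    coeff (Finsupp.sumElim α (β.embDomain Fin.castSuccEmb)) c.Q

/-- `M` belongs to the class `𝒞`: in normal coordinates, for all large `k` the formal map
`χ ↦ (Q_{z^α}(0, χ, 0))_{|α| ≤ k}` has generic rank `n = N - 1`. (The condition does not depend on
the normal coordinates.) -/
def InClassC {n : ℕ} (M : FormalRealHypersurface (n + 1)) : Prop :=
  ∃ c : NormalCoordinates M, ∃ k₀ : ℕ, ∀ k ≥ k₀,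
    genericRank (fun α : {α : Fin n →₀ ℕ // α.degree ≤ k} => c.QDeriv α.1) = n

end FormalRealHypersurface

open FormalRealHypersurface

/-! ### Maps between formal real hypersurfaces -/

/-- `H` sends `M` into `M'`: `h ∘ ℋ` lies in the ideal of `M` for every `h` in the ideal of `M'`,
where `ℋ(Z, ζ) = (H(Z), H̄(ζ))`. -/
def SendsInto {N : ℕ} (H : FormalMap N N) (M M' : FormalRealHypersurface N) : Prop :=
  ∀ h ∈ M'.ideal, subst H.complexify h ∈ M.ideal

/-- `H` is CR-transversal to `M'`: `T₀^{1,0} M' + dH(T₀ ℂ^N) = T₀ ℂ^N`. -/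
def CRTransversal {N : ℕ} (H : FormalMap N N) (M' : FormalRealHypersurface N) : Prop :=
  M'.holTangentSpace ⊔ LinearMap.range H.differentialMatrix.mulVecLin = ⊤

/-- The map `H` expressed in normal coordinates for `M` and `M'`. Its last component is `G`, the
first `n` components are `F`. -/
def inCoordinates {n : ℕ} {M M' : FormalRealHypersurface (n + 1)} (c : NormalCoordinates M)
    (c' : NormalCoordinates M') (H : FormalMap (n + 1) (n + 1)) : FormalMap (n + 1) (n + 1) :=
  c'.chartInv.comp (H.comp c.chart)

/-- `H` is transversally nonflat: its transversal component `G` in some system of normal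
coordinates is not identically zero. -/
def TransversallyNonflat {n : ℕ} (H : FormalMap (n + 1) (n + 1))
    (M M' : FormalRealHypersurface (n + 1)) : Prop :=
  ∃ (c : NormalCoordinates M) (c' : NormalCoordinates M'),
    (inCoordinates c c' H).toFun (Fin.last n) ≠ 0

/-- `H` is not totally degenerate: the matrix `(∂F/∂z)(z, 0)`, a square matrix of size `n = N - 1`
over `ℂ⟦z⟧`, has rank `n` in every system of normal coordinates. -/
def NotTotallyDegenerate {n : ℕ} (H : FormalMap (n + 1) (n + 1))
    (M M' : FormalRealHypersurface (n + 1)) : Prop :=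
  ∀ (c : NormalCoordinates M) (c' : NormalCoordinates M'),
    (Matrix.of fun i j : Fin n =>
      subst (Fin.snoc (fun l : Fin n => X l) 0 : Fin (n + 1) → MvPowerSeries (Fin n) ℂ)
        (pderiv ℂ j.castSucc ((inCoordinates c c' H).toFun i.castSucc))).rank = n

end FormalCR

end

noncomputable section

namespace FormalCR

open MvPowerSeries

/-! ### Substitution into formal power series -/

/-! Let `r` and `r'` define `M` and `M'`, with `M` in normal coordinates `w = Q(z, χ, τ)`.
Everything rests on the identity `r'(H(Z), H̄(ζ)) = A · r(Z, ζ)`.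

Nondegeneracy. Let a vector field `D` in the variables `ζ = (χ, τ)` kill `H̄`. Then `D` kills `r'(H,
H̄)`, a multiple of the prime `w - Q` which is nonzero because `H` is transversally nonflat. In
characteristic zero `D` must preserve the ideal `(w - Q)` (`prime_dvd_derivation`), and as `D(w - Q)
= -DQ` does not involve `w`, it follows that `DQ = 0` (`sum_mul_pderiv_eq_zero`). So `D` kills every
`z`-coefficient of `Q`, and the class `𝒞` gives `D = 0`. Over all `(χ, τ)` this says that the
Jacobian determinant `J` of `H̄` is nonzero; over `τ = 0` it says that no nonzero field kills `z ↦
H(z, 0)`, and since `G(z, 0) = 0` this is the failure of total degeneracy.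

Transversality. It suffices that `A(0) ≠ 0`. Differentiating the identity in `ζ` on `M` and
multiplying by the adjugate of the Jacobian matrix of `H̄` shows that `A` restricted to `M` divides
a unit times `J(χ, τ)`, which is free of `z` (`exists_subst_graphMap_mul_eq`). Hence along a curve
in `M` on which `J` does not vanish, the order of `A` does not change when only the Segre coordinate
`z` is moved (`associated_subst_of_mul_eq`). Since `A` is real, `χ` can likewise be moved with `(z,
w)` fixed. Moving both to nearly zero shows that the order of `A` is that of `A(0, w, 0, w)`, that
is, `s · ord w` for a fixed `s` (`associated_diagonal`). By reality it is also `s · ord τ`. As `Q(z,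
χ, 0) ≠ 0`, some curve in `M` has `ord τ > ord w`; therefore `s = 0` and `A` is a unit. -/

/-- Reduces identities between power series to polynomials: the remainder has arbitrarily high
order, which plays the part of continuity throughout. -/
theorem exists_eq_coe_add {σ : Type*} [Finite σ] (f : MvPowerSeries σ ℂ) (k : ℕ) :
    ∃ (p : MvPolynomial σ ℂ) (g : MvPowerSeries σ ℂ), f = (p : MvPowerSeries σ ℂ) + g ∧
      (k : ℕ∞) ≤ g.order := by
  refine ⟨truncTotal k f, f - truncTotal k f, by ring, nat_le_order fun d hd => ?_⟩
  rw [map_sub, MvPolynomial.coeff_coe, coeff_truncTotal _ hd, sub_self]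

theorem le_order_subst_of_constantCoeff_zero {σ τ : Type*} [Finite σ]
    {a : σ → MvPowerSeries τ ℂ} (ha : ∀ i, constantCoeff (a i) = 0) (f : MvPowerSeries σ ℂ) :
    f.order ≤ (subst a f).order := by
  refine le_trans ?_ (le_order_subst (hasSubst_of_constantCoeff_zero ha) f)
  calc f.order = 1 * f.order := (one_mul _).symm
    _ ≤ _ := by
      gcongr
      exact le_iInf fun i => one_le_order_iff_constCoeff_eq_zero.2 (ha i)

theorem le_order_pderiv {σ : Type*} (i : σ) (f : MvPowerSeries σ ℂ) (k : ℕ)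
    (hf : ((k + 1 : ℕ) : ℕ∞) ≤ f.order) : (k : ℕ∞) ≤ (pderiv ℂ i f).order := by
  refine nat_le_order fun d hd => ?_
  rw [coeff_pderiv, coeff_of_lt_order, zero_mul]
  refine lt_of_lt_of_le ?_ hf
  rw [map_add, Finsupp.degree_single]
  exact_mod_cast Nat.add_lt_add_right hd 1

/-- The chain rule for formal power series. -/
theorem pderiv_subst {σ τ : Type*} [Fintype σ] {a : σ → MvPowerSeries τ ℂ}
    (ha : ∀ i, constantCoeff (a i) = 0) (f : MvPowerSeries σ ℂ) (j : τ) :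
    pderiv ℂ j (subst a f) = ∑ i, subst a (pderiv ℂ i f) * pderiv ℂ j (a i) := by
  have hs := hasSubst_of_constantCoeff_zero ha
  have hpoly : ∀ p : MvPolynomial σ ℂ, pderiv ℂ j (subst a (p : MvPowerSeries σ ℂ)) =
      ∑ i, subst a (pderiv ℂ i (p : MvPowerSeries σ ℂ)) * pderiv ℂ j (a i) := by
    intro p
    simp only [pderiv_coe, subst_coe]
    induction p using MvPolynomial.induction_on with
    | C c => simp
    | add p q hp hq => simp only [map_add, hp, hq, add_mul, Finset.sum_add_distrib]
    | mul_X p i hp =>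
      classical
      simp only [map_mul, Derivation.leibniz, smul_eq_mul, map_add, hp, MvPolynomial.aeval_X,
        MvPolynomial.pderiv_X, add_mul, Finset.sum_add_distrib, Finset.mul_sum]
      congr 1
      · rw [Finset.sum_eq_single i]
        · simp
        · intro b _ hb
          simp [hb.symm]
        · simp
      · exact Finset.sum_congr rfl fun _ _ => by ring
  -- Polynomials satisfy the chain rule exactly, so the defect comes from the remainder alone and
  -- has order at least `k` for every `k`. The remainder is taken of order `k + 1` because a
  -- derivative lowers the order by one.
  rw [← sub_eq_zero, ← order_eq_top_iff, ENat.eq_top_iff_forall_ge]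
  intro k
  obtain ⟨p, g, rfl, hg⟩ := exists_eq_coe_add f (k + 1)
  have : pderiv ℂ j (subst a ((p : MvPowerSeries σ ℂ) + g)) -
      ∑ i, subst a (pderiv ℂ i ((p : MvPowerSeries σ ℂ) + g)) * pderiv ℂ j (a i) =
      pderiv ℂ j (subst a g) - ∑ i, subst a (pderiv ℂ i g) * pderiv ℂ j (a i) := by
    simp only [subst_add hs, map_add, hpoly, add_mul, Finset.sum_add_distrib]
    ring
  rw [this]
  refine nat_le_order fun d hd => ?_
  have hd' : ((d.degree : ℕ) : ℕ∞) < k := by exact_mod_cast hd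
  rw [map_sub, map_sum, coeff_of_lt_order, Finset.sum_eq_zero, sub_zero]
  · intro i _
    refine coeff_of_lt_order (hd'.trans_le ?_)
    exact (le_order_pderiv i g k hg).trans
      ((le_order_subst_of_constantCoeff_zero ha _).trans (le_self_add.trans le_order_mul))
  · exact hd'.trans_le
      (le_order_pderiv j _ k (hg.trans (le_order_subst_of_constantCoeff_zero ha _)))

theorem subst_zero_right {σ τ : Type*} [Finite σ] {a : σ → MvPowerSeries τ ℂ}
    (ha : ∀ i, constantCoeff (a i) = 0) : subst a (0 : MvPowerSeries σ ℂ) = 0 := by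
  rw [← coe_substAlgHom (hasSubst_of_constantCoeff_zero ha), map_zero]

theorem constantCoeff_subst_of_zero {σ τ : Type*} [Finite σ] {a : σ → MvPowerSeries τ ℂ}
    (ha : ∀ i, constantCoeff (a i) = 0) (f : MvPowerSeries σ ℂ) :
    constantCoeff (subst a f) = constantCoeff f := by
  have hs := hasSubst_of_constantCoeff_zero ha
  have h : constantCoeff (subst a (f - C (constantCoeff f))) = 0 :=
    constantCoeff_subst_eq_zero hs ha (by simp)
  rw [subst_sub hs, map_sub, sub_eq_zero] at h
  rw [h, ← coe_substAlgHom hs, c_eq_algebraMap, AlgHom.commutes]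
  simp [MvPowerSeries.algebraMap_apply]

theorem isUnit_subst {σ τ : Type*} [Finite σ] {a : σ → MvPowerSeries τ ℂ}
    (ha : ∀ i, constantCoeff (a i) = 0) {f : MvPowerSeries σ ℂ} (hf : IsUnit f) :
    IsUnit (subst a f) := by
  rw [isUnit_iff_constantCoeff] at hf ⊢
  rwa [constantCoeff_subst_of_zero ha]

theorem subst_rename {σ τ υ : Type*} [Finite σ] [Finite τ] {a : τ → MvPowerSeries υ ℂ}
    (ha : ∀ i, constantCoeff (a i) = 0) (g : σ → τ) (f : MvPowerSeries σ ℂ) :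
    subst a (rename g f) = subst (a ∘ g) f := by
  have hs := hasSubst_of_constantCoeff_zero ha
  rw [rename_eq_subst, subst_comp_subst_apply (HasSubst.X_comp g) hs]
  congr 1
  funext i
  simp [subst_X hs]

theorem rename_subst {σ τ υ : Type*} [Finite σ] [Finite τ] [Finite υ] {a : σ → MvPowerSeries τ ℂ}
    (ha : ∀ i, constantCoeff (a i) = 0) (g : τ → υ) (f : MvPowerSeries σ ℂ) :
    rename g (subst a f) = subst (fun i => rename g (a i)) f := by
  rw [rename_eq_subst, subst_comp_subst_apply (hasSubst_of_constantCoeff_zero ha)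
    (HasSubst.X_comp g)]
  simp only [rename_eq_subst]

/-- Substitution of tuples that agree modulo `π` gives results that agree modulo `π ^ k`. -/
theorem dvd_subst_sub_subst {σ : Type*} [Finite σ] {a b : σ → MvPowerSeries Unit ℂ}
    (ha : ∀ i, constantCoeff (a i) = 0) (hb : ∀ i, constantCoeff (b i) = 0) {k : ℕ}
    (hab : ∀ i, X () ^ k ∣ a i - b i) (f : MvPowerSeries σ ℂ) :
    X () ^ k ∣ subst a f - subst b f := by
  have hsa := hasSubst_of_constantCoeff_zero ha
  have hsb := hasSubst_of_constantCoeff_zero hb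
  obtain ⟨p, g, rfl, hg⟩ := exists_eq_coe_add f k
  have key : ∀ {h : MvPowerSeries Unit ℂ}, (k : ℕ∞) ≤ h.order → X () ^ k ∣ h := by
    intro h hh
    rw [X_pow_dvd_iff]
    intro m hm
    refine coeff_of_lt_order (lt_of_lt_of_le ?_ hh)
    simpa [Finsupp.degree_eq_sum] using hm
  rw [subst_add hsa, subst_add hsb, add_sub_add_comm]
  refine dvd_add ?_ (dvd_sub (key (hg.trans (le_order_subst_of_constantCoeff_zero ha g)))
    (key (hg.trans (le_order_subst_of_constantCoeff_zero hb g))))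
  rw [subst_coe, subst_coe, ← Ideal.mem_span_singleton, ← Ideal.Quotient.eq]
  set I := Ideal.span {(X () : MvPowerSeries Unit ℂ) ^ k}
  have : ∀ c : σ → MvPowerSeries Unit ℂ, Ideal.Quotient.mk I (MvPolynomial.aeval c p) =
      MvPolynomial.aeval (fun i => Ideal.Quotient.mk I (c i)) p := fun c =>
    MvPolynomial.comp_aeval_apply (φ := Ideal.Quotient.mkₐ ℂ I) c p
  rw [this, this]
  congr 2
  funext i
  rw [Ideal.Quotient.eq, Ideal.mem_span_singleton]
  exact hab i

/-- The homomorphisms are not assumed continuous; not lowering the order is what lets agreement on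
polynomials pass to all power series. -/
theorem algHom_ext_of_le_order {σ τ : Type*} [Finite σ]
    {φ ψ : MvPowerSeries σ ℂ →ₐ[ℂ] MvPowerSeries τ ℂ} (hφ : ∀ f, f.order ≤ (φ f).order)
    (hψ : ∀ f, f.order ≤ (ψ f).order) (h : ∀ i, φ (X i) = ψ (X i)) : φ = ψ := by
  have hp : φ.comp (MvPolynomial.coeToMvPowerSeries.algHom ℂ) =
      ψ.comp (MvPolynomial.coeToMvPowerSeries.algHom ℂ) := by
    refine MvPolynomial.algHom_ext fun i => ?_
    simpa using h i
  ext1 f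
  rw [← sub_eq_zero, ← order_eq_top_iff, ENat.eq_top_iff_forall_ge]
  intro k
  obtain ⟨p, g, rfl, hg⟩ := exists_eq_coe_add f k
  have h1 : φ (p : MvPowerSeries σ ℂ) = ψ (p : MvPowerSeries σ ℂ) := by
    simpa using DFunLike.congr_fun hp p
  rw [map_add, map_add, h1, add_sub_add_left_eq_sub]
  refine nat_le_order fun d hd => ?_
  have hd' : ((d.degree : ℕ) : ℕ∞) < k := by exact_mod_cast hd
  rw [map_sub, coeff_of_lt_order (hd'.trans_le (hg.trans (hφ g))),
    coeff_of_lt_order (hd'.trans_le (hg.trans (hψ g))), sub_zero]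

theorem subst_eq_killCompl {σ τ : Type*} [Finite τ] (e : σ ↪ τ) {a : τ → MvPowerSeries σ ℂ}
    (h1 : ∀ i, a (e i) = X i) (h2 : ∀ t ∉ Set.range e, a t = 0) (f : MvPowerSeries τ ℂ) :
    subst a f = killCompl e f := by
  have ha : ∀ t, constantCoeff (a t) = 0 := by
    intro t
    by_cases ht : t ∈ Set.range e
    · obtain ⟨i, rfl⟩ := ht
      simp [h1]
    · simp [h2 t ht]
  have hs := hasSubst_of_constantCoeff_zero ha
  rw [← coe_substAlgHom hs]
  refine DFunLike.congr_fun (algHom_ext_of_le_order ?_ ?_ ?_) f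
  · intro f
    rw [coe_substAlgHom hs]
    exact le_order_subst_of_constantCoeff_zero ha f
  · intro f
    refine le_order fun d hd => ?_
    rw [coeff_killCompl]
    refine coeff_of_lt_order ?_
    have : (Finsupp.embDomain e d).degree = d.degree := by
      rw [Finsupp.embDomain_eq_mapDomain, Finsupp.degree_mapDomain]
    rwa [this]
  · intro t
    rw [substAlgHom_X]
    by_cases ht : t ∈ Set.range e
    · obtain ⟨i, rfl⟩ := ht
      simp [h1]
    · rw [h2 t ht, killCompl_X_eq_zero ht]

theorem X_dvd_iff_killCompl {σ τ : Type*} {e : σ ↪ τ} {s : τ} (he : Set.range e = {s}ᶜ)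
    {f : MvPowerSeries τ ℂ} : X s ∣ f ↔ killCompl e f = 0 := by
  rw [X_dvd_iff, MvPowerSeries.ext_iff]
  constructor
  · intro h x
    rw [coeff_killCompl, coeff_zero]
    refine h _ (Finsupp.embDomain_of_notMem_range _ _ _ ?_)
    simp [he]
  · intro h m hm
    have : m ∈ Set.range (Finsupp.embDomain e) := by
      rw [Finsupp.mem_range_embDomain_iff, he]
      intro t ht
      rintro rfl
      simp [hm] at ht
    obtain ⟨x, rfl⟩ := this
    simpa [coeff_killCompl] using h x

/-- The ideal `(X s)` is the kernel of the restriction to `X s = 0`, whose target is a domain. -/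
theorem X_prime {σ : Type*} (s : σ) : Prime (X s : MvPowerSeries σ ℂ) := by
  have he : Set.range (Function.Embedding.subtype (· ∈ ({s}ᶜ : Set σ))) = {s}ᶜ :=
    Subtype.range_coe
  refine ⟨?_, ?_, fun f g h => ?_⟩
  · intro h
    have := coeff_index_single_self_X (R := ℂ) s
    simp [h] at this
  · intro h
    rw [isUnit_iff_constantCoeff] at h
    simp at h
  · rw [X_dvd_iff_killCompl he, map_mul, mul_eq_zero] at h
    rwa [X_dvd_iff_killCompl he, X_dvd_iff_killCompl he]

/-- In one variable every nonzero series is a power of the variable up to a unit. -/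
theorem associated_X_pow {f : MvPowerSeries Unit ℂ} (hf : f ≠ 0) :
    ∃ l : ℕ, Associated f (X () ^ l) := by
  have hfin : FiniteMultiplicity (X () : MvPowerSeries Unit ℂ) f := by
    by_contra h
    rw [FiniteMultiplicity.not_iff_forall] at h
    refine hf (MvPowerSeries.ext fun d => ?_)
    exact (X_pow_dvd_iff.1 (h (d () + 1))) d (Nat.lt_succ_self _)
  obtain ⟨g, hg, hndvd⟩ := hfin.exists_eq_pow_mul_and_not_dvd
  refine ⟨multiplicity (X ()) f, ?_⟩
  have hu : IsUnit g := by
    rw [isUnit_iff_constantCoeff, isUnit_iff_ne_zero]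
    intro h0
    refine hndvd (X_dvd_iff.2 fun m hm => ?_)
    have : m = 0 := by
      ext
      simpa using hm
    simpa [this] using h0
  conv_lhs => rw [hg]
  exact associated_mul_unit_left _ _ hu

/-! ### Division by a graph -/

/-- A derivation that kills a nonzero multiple of a prime `p` preserves the ideal `(p)`. -/
theorem prime_dvd_derivation {R : Type*} [CommRing R] [IsDomain R] [Algebra ℂ R]
    (D : Derivation ℂ R R) {p f : R} (hp : Prime p) (hfin : FiniteMultiplicity p f) (hf : p ∣ f)
    (hD : D f = 0) : p ∣ D p := by
  obtain ⟨g, hg, hndvd⟩ := hfin.exists_eq_pow_mul_and_not_dvd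
  obtain ⟨m, hm⟩ : ∃ m, multiplicity p f = m + 1 := by
    refine Nat.exists_eq_succ_of_ne_zero fun h => ?_
    rw [h, pow_zero, one_mul] at hg
    exact hndvd (hg ▸ hf)
  rw [hm] at hg
  rw [hg, Derivation.leibniz, Derivation.leibniz_pow] at hD
  simp only [smul_eq_mul, nsmul_eq_mul, Nat.add_sub_cancel] at hD
  have h : p ^ m * (p * D g + (m + 1 : ℕ) * (g * D p)) = 0 := by
    rw [← hD]; ring
  have h2 := (mul_eq_zero.1 h).resolve_left (pow_ne_zero _ hp.ne_zero)
  -- Characteristic zero enters here: the exponent produced by differentiating `p ^ (m + 1)` is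
  -- invertible.
  have hu : IsUnit ((m + 1 : ℕ) : R) := by
    have : IsUnit ((m + 1 : ℕ) : ℂ) := isUnit_iff_ne_zero.2 (by exact_mod_cast m.succ_ne_zero)
    simpa using this.map (algebraMap ℂ R)
  have h3 : p ∣ (m + 1 : ℕ) * (g * D p) := by
    rw [eq_neg_of_add_eq_zero_right h2]
    exact (dvd_mul_right _ _).neg_right
  exact (hp.dvd_or_dvd (hu.dvd_mul_left.1 h3)).resolve_left hndvd

/-- A multiple of `p ^ k` has order at least `k`, so only zero is divisible by all powers. -/
theorem finiteMultiplicity_of_constantCoeff_zero {σ : Type*} {p f : MvPowerSeries σ ℂ}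
    (hp : constantCoeff p = 0) (hf : f ≠ 0) : FiniteMultiplicity p f := by
  by_contra h
  rw [FiniteMultiplicity.not_iff_forall] at h
  rw [Ne, ← order_eq_top_iff, ENat.eq_top_iff_forall_ge] at hf
  refine hf fun k => ?_
  obtain ⟨g, hg⟩ := h k
  rw [hg]
  exact (le_order_pow_of_constantCoeff_eq_zero k hp).trans (le_self_add.trans le_order_mul)

/-- The ideal of the graph `x_s = q` consists of the power series that vanish on it. -/
theorem X_sub_rename_dvd_iff {σ κ : Type*} [Finite σ] {e : κ ↪ σ} {s : σ}
    (he : Set.range e = {s}ᶜ) {q : MvPowerSeries κ ℂ} (hq : constantCoeff q = 0)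
    {a : σ → MvPowerSeries κ ℂ} (h1 : ∀ i, a (e i) = X i) (h2 : a s = q)
    {f : MvPowerSeries σ ℂ} : X s - rename e q ∣ f ↔ subst a f = 0 := by
  classical
  have : Finite κ := Finite.of_injective e e.injective
  have hcases : ∀ t, t = s ∨ ∃ i, e i = t := by
    intro t
    by_cases ht : t = s
    · exact Or.inl ht
    · right
      have : t ∈ Set.range e := by rw [he]; exact ht
      exact this
  have hes : ∀ i, e i ≠ s := fun i h => by
    have : e i ∈ Set.range e := ⟨i, rfl⟩
    rw [he] at this
    exact this h
  have ha : ∀ t, constantCoeff (a t) = 0 := by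
    intro t
    rcases hcases t with rfl | ⟨i, rfl⟩
    · rw [h2, hq]
    · simp [h1]
  have hsa := hasSubst_of_constantCoeff_zero ha
  constructor
  · rintro ⟨g, rfl⟩
    have : a ∘ e = X := funext h1
    rw [subst_mul hsa, subst_sub hsa, subst_X hsa, subst_rename ha, h2, this, subst_self]
    simp
  · intro hf
    -- The shear `x_s ↦ x_s + q` straightens the graph to the hyperplane `x_s = 0`, where
    -- divisibility is read off from `killCompl`; the shear by `-q` carries the result back.
    set P : MvPowerSeries σ ℂ → σ → MvPowerSeries σ ℂ := fun c => Function.update X s (X s + c)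
    have hP : ∀ q' : MvPowerSeries κ ℂ, constantCoeff q' = 0 →
        ∀ t, constantCoeff (P (rename e q') t) = 0 := by
      intro q' hq' t
      rcases hcases t with rfl | ⟨i, rfl⟩
      · simp [P, hq']
      · simp [P, Function.update_of_ne (hes i)]
    have hPe : ∀ q' : MvPowerSeries κ ℂ, P (rename e q') ∘ e = X ∘ e := by
      intro q'
      funext i
      simp [P, Function.update_of_ne (hes i)]
    have hp1 := hP q hq
    have hp2 := hP (-q) (by simp [hq])
    have hs1 := hasSubst_of_constantCoeff_zero hp1
    have hs2 := hasSubst_of_constantCoeff_zero hp2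
    have hk : killCompl e (subst (P (rename e q)) f) = 0 := by
      set b : σ → MvPowerSeries κ ℂ := fun t => killCompl e (X t)
      have hb1 : ∀ i, b (e i) = X i := fun i => killCompl_X i
      have hb2 : ∀ t ∉ Set.range e, b t = 0 := fun t ht => killCompl_X_eq_zero ht
      have hb : ∀ t, constantCoeff (b t) = 0 := by
        intro t
        rcases hcases t with rfl | ⟨i, rfl⟩
        · rw [hb2]
          · simp
          · rw [he]; simp
        · simp [hb1]
      have hsb := hasSubst_of_constantCoeff_zero hb
      rw [← subst_eq_killCompl e hb1 hb2, subst_comp_subst_apply hs1 hsb, ← hf]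
      congr 1
      funext t
      rcases hcases t with rfl | ⟨i, rfl⟩
      · have hbe : b ∘ e = X := funext hb1
        have hbt : b t = 0 := hb2 t (by rw [he]; simp)
        simp only [P, Function.update_self]
        rw [subst_add hsb, subst_X hsb, subst_rename hb, hbe, subst_self, h2, hbt]
        simp
      · simp [P, Function.update_of_ne (hes i), subst_X hsb, hb1, h1]
    obtain ⟨g, hg⟩ := (X_dvd_iff_killCompl he).2 hk
    have hinv : subst (P (rename e (-q))) (subst (P (rename e q)) f) = f := by
      rw [subst_comp_subst_apply hs1 hs2]
      conv_rhs => rw [← id_eq f, ← subst_self]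
      congr 1
      funext t
      rcases hcases t with rfl | ⟨i, rfl⟩
      · conv_lhs => simp only [P, Function.update_self]
        rw [subst_add hs2, subst_X hs2, subst_rename hp2, hPe, ← rename_eq_subst]
        simp [P]
      · have : P (rename e q) (e i) = X (e i) := by simp [P, Function.update_of_ne (hes i)]
        rw [this, subst_X hs2]
        simp [P, Function.update_of_ne (hes i)]
    rw [← hinv, hg, subst_mul hs2, subst_X hs2]
    simp [P, sub_eq_add_neg]

/-- The ideal of the graph is the kernel of the restriction to the graph, a homomorphism into a
domain. -/
theorem prime_X_sub_rename {σ κ : Type*} [Finite σ] {e : κ ↪ σ} {s : σ}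
    (he : Set.range e = {s}ᶜ) {q : MvPowerSeries κ ℂ} (hq : constantCoeff q = 0)
    {a : σ → MvPowerSeries κ ℂ} (h1 : ∀ i, a (e i) = X i) (h2 : a s = q) :
    Prime (X s - rename e q) := by
  have ha : ∀ t, constantCoeff (a t) = 0 := by
    intro t
    by_cases ht : t = s
    · rw [ht, h2, hq]
    · have : t ∈ Set.range e := by rw [he]; exact ht
      obtain ⟨i, rfl⟩ := this
      simp [h1]
  have hsa := hasSubst_of_constantCoeff_zero ha
  refine ⟨?_, ?_, fun f g h => ?_⟩
  · intro h
    have hr : killCompl e (X s - rename e q) = 0 := by rw [h, map_zero]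
    rw [map_sub, killCompl_X_eq_zero (by rw [he]; simp), killCompl_rename_app] at hr
    have hq0 : q = 0 := by simpa using hr
    rw [hq0, map_zero, sub_zero] at h
    exact (X_prime s).ne_zero h
  · intro h
    rw [isUnit_iff_constantCoeff] at h
    simp [hq] at h
  · rw [X_sub_rename_dvd_iff he hq h1 h2] at h ⊢
    rw [X_sub_rename_dvd_iff he hq h1 h2]
    rwa [subst_mul hsa, mul_eq_zero] at h

/-! ### Generic curves -/

/-- A nonzero power series does not vanish on a generic curve that is highly tangent to the
last coordinate axis. -/
theorem exists_curve_subst_ne_zero {ι : Type*} [Finite ι] {g : MvPowerSeries (ι ⊕ Unit) ℂ}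
    (hg : g ≠ 0) (k : ℕ) : ∃ a : ι → MvPowerSeries Unit ℂ, (∀ i, X () ^ (k + 1) ∣ a i) ∧
      subst (Sum.elim a fun _ => X ()) g ≠ 0 := by
  classical
  have := Fintype.ofFinite ι
  obtain ⟨d₀, hd₀⟩ := (ne_zero_iff_exists_coeff_ne_zero g).1 hg
  -- On the curve `x_i = b_i t ^ (k + 1)` a monomial contributes exactly at the power `t ^ wt d`.
  -- The coefficient of `t ^ N` is therefore a polynomial `P` in `b`; distinct monomials of the same
  -- weight stay distinct in `P`, so `P ≠ 0` and a suitable `b` exists.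
  set wt : (ι ⊕ Unit →₀ ℕ) → ℕ := fun d => (k + 1) * (∑ i, d (Sum.inl i)) + d (Sum.inr ())
  set res : (ι ⊕ Unit →₀ ℕ) → (ι →₀ ℕ) := fun d =>
    Finsupp.equivFunOnFinite.symm fun i => d (Sum.inl i)
  have hinj : ∀ d d', wt d = wt d' → res d = res d' → d = d' := by
    intro d d' h1 h2
    have h3 : ∀ i, d (Sum.inl i) = d' (Sum.inl i) := fun i => DFunLike.congr_fun h2 i
    ext (i | i)
    · exact h3 i
    · simp only [wt, h3] at h1
      exact Nat.add_left_cancel h1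
  set N := wt d₀
  have hfin : {d | wt d = N}.Finite := by
    refine Set.Finite.subset (Set.finite_Iic (Finsupp.equivFunOnFinite.symm fun _ => N)) ?_
    intro d hd
    rw [Set.mem_ofPred_eq] at hd
    rw [Set.mem_Iic]
    rintro (i | i)
    · have : d (Sum.inl i) ≤ ∑ i, d (Sum.inl i) :=
        Finset.single_le_sum (f := fun i => d (Sum.inl i)) (fun _ _ => Nat.zero_le _)
          (Finset.mem_univ i)
      simp only [Finsupp.equivFunOnFinite_symm_apply_apply, ← hd, wt]
      nlinarith
    · simp only [Finsupp.equivFunOnFinite_symm_apply_apply, ← hd, wt]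
      exact Nat.le_add_left _ _
  set P : MvPolynomial ι ℂ := ∑ d ∈ hfin.toFinset, MvPolynomial.monomial (res d) (coeff d g)
  have hP : P ≠ 0 := by
    intro h
    have h2 : MvPolynomial.coeff (res d₀) P = coeff d₀ g := by
      simp only [P, MvPolynomial.coeff_sum, MvPolynomial.coeff_monomial]
      rw [Finset.sum_eq_single d₀]
      · simp
      · intro d hd hne
        rw [if_neg]
        intro h
        exact hne (hinj d d₀ (by simpa using hd) h)
      · simp [N]
    rw [h] at h2
    exact hd₀ (by simpa using h2.symm)
  obtain ⟨b, hb⟩ : ∃ b, MvPolynomial.eval b P ≠ 0 := by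
    by_contra! h
    exact hP (MvPolynomial.funext fun x => by simp [h x])
  refine ⟨fun i => C (b i) * X () ^ (k + 1), fun i => dvd_mul_left _ _, fun h => hb ?_⟩
  set a : ι → MvPowerSeries Unit ℂ := fun i => C (b i) * X () ^ (k + 1)
  have ha : ∀ i, constantCoeff (Sum.elim a (fun _ : Unit => X ()) i) = 0 := by
    rintro (i | i) <;> simp [a]
  have hc := congrArg (coeff (Finsupp.single () N)) h
  rw [coeff_subst (hasSubst_of_constantCoeff_zero ha), coeff_zero] at hc
  have hterm : ∀ d : ι ⊕ Unit →₀ ℕ, coeff d g • coeff (Finsupp.single () N)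
      (d.prod fun s e => Sum.elim a (fun _ : Unit => X ()) s ^ e) =
      if wt d = N then coeff d g * ∏ i, b i ^ d (Sum.inl i) else 0 := by
    intro d
    have h1 : (d.prod fun s e => Sum.elim a (fun _ : Unit => X ()) s ^ e) =
        C (∏ i, b i ^ d (Sum.inl i)) * X () ^ wt d := by
      rw [Finsupp.prod_fintype _ _ (by simp), Fintype.prod_sum_type]
      simp only [Sum.elim_inl, Sum.elim_inr, a, mul_pow, Finset.prod_mul_distrib, ← pow_mul, wt,
        Finset.mul_sum, Finset.prod_pow_eq_pow_sum, map_prod, map_pow, Finset.univ_unique]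
      rw [pow_add _ (∑ i, (k + 1) * d (Sum.inl i)), mul_assoc]
      rfl
    rw [h1, coeff_C_mul, coeff_X_pow, smul_eq_mul]
    by_cases hw : wt d = N
    · simp [hw]
    · have : ¬ Finsupp.single () N = Finsupp.single () (wt d) := fun h =>
        hw (by simpa using (DFunLike.congr_fun h ()).symm)
      simp [hw, this]
  rw [finsum_congr hterm, finsum_eq_sum_of_support_subset (s := hfin.toFinset)] at hc
  · rw [← hc]
    simp only [P, map_sum, MvPolynomial.eval_monomial]
    refine Finset.sum_congr rfl fun d hd => ?_
    rw [if_pos (by simpa using hd), Finsupp.prod_fintype _ _ (by simp)]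
    rfl
  · intro d hd
    by_contra hcon
    simp only [Function.mem_support] at hd
    exact hd (if_neg (by simpa using hcon))

/-- If `a` divides, up to a unit, a power series that does not depend on the first group of
variables, then along a curve the order of `a` does not depend on these variables. -/
theorem associated_subst_of_mul_eq {κ μ : Type*} [Finite κ] [Finite μ]
    {a y u : MvPowerSeries (κ ⊕ μ) ℂ} {j : MvPowerSeries μ ℂ} (hu : IsUnit u)
    (h : a * y = u * rename Sum.inr j) {γ : μ → MvPowerSeries Unit ℂ}
    (hγ : ∀ i, constantCoeff (γ i) = 0) (hj : subst γ j ≠ 0) {z z' : κ → MvPowerSeries Unit ℂ}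
    (hz : ∀ i, constantCoeff (z i) = 0) (hz' : ∀ i, constantCoeff (z' i) = 0) :
    Associated (subst (Sum.elim z γ) a) (subst (Sum.elim z' γ) a) := by
  -- Only the second group is put on the curve; the first stays free. In the resulting ring the
  -- variable `t` is prime and `a` divides a unit times `t ^ l`, so `a` is itself a unit times `t ^
  -- i`, with `i` fixed before the free variables are specialised.
  set θ : κ ⊕ μ → MvPowerSeries (κ ⊕ Unit) ℂ :=
    Sum.elim (fun i => X (Sum.inl i)) (fun i => rename Sum.inr (γ i))
  have hθ : ∀ i, constantCoeff (θ i) = 0 := by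
    rintro (i | i) <;> simp [θ, hγ]
  have hsθ := hasSubst_of_constantCoeff_zero hθ
  obtain ⟨l, hl⟩ := associated_X_pow hj
  have h1 : Associated (subst θ a * subst θ y) (X (Sum.inr ()) ^ l) := by
    rw [← subst_mul hsθ, h, subst_mul hsθ, subst_rename hθ]
    have h2 : subst (θ ∘ Sum.inr) j = rename Sum.inr (subst γ j) := by
      rw [rename_subst hγ]; rfl
    rw [h2]
    have h3 := hl.map (rename (R := ℂ) (Sum.inr : Unit → κ ⊕ Unit))
    rw [map_pow, rename_X] at h3
    exact (associated_unit_mul_left _ _ (isUnit_subst hθ hu)).trans h3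
  obtain ⟨i, -, hi⟩ := (dvd_prime_pow (X_prime (Sum.inr () : κ ⊕ Unit)) l).1
    ((dvd_mul_right _ _).trans h1.dvd)
  have key : ∀ {z : κ → MvPowerSeries Unit ℂ}, (∀ i, constantCoeff (z i) = 0) →
      Associated (subst (Sum.elim z γ) a) (X () ^ i) := by
    intro z hz
    set b : κ ⊕ Unit → MvPowerSeries Unit ℂ := Sum.elim z (fun _ => X ())
    have hb : ∀ i, constantCoeff (b i) = 0 := by
      rintro (i | i) <;> simp [b, hz]
    have hsb := hasSubst_of_constantCoeff_zero hb
    have h2 : subst (Sum.elim z γ) a = subst b (subst θ a) := by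
      rw [subst_comp_subst_apply hsθ hsb]
      congr 1
      funext t
      rcases t with t | t
      · simp [θ, b, subst_X hsb]
      · simp only [θ, Sum.elim_inr]
        rw [subst_rename hb]
        have : b ∘ Sum.inr = X := rfl
        rw [this, subst_self, id]
    have h3 := hi.map (substAlgHom (S := ℂ) hsb)
    rw [map_pow, coe_substAlgHom, subst_X hsb] at h3
    rw [h2]
    exact h3
  exact (key hz).trans (key hz').symm

instance isDomain_mvPowerSeries {σ : Type*} : IsDomain (MvPowerSeries σ ℂ) :=
  NoZeroDivisors.to_isDomain _

/-! ### Partial expansions and derivatives -/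

theorem pderiv_rename {σ τ : Type*} [Finite σ] {g : σ → τ} (hg : Function.Injective g) (i : σ)
    (f : MvPowerSeries σ ℂ) : pderiv ℂ (g i) (rename g f) = rename g (pderiv ℂ i f) := by
  classical
  have := Fintype.ofFinite σ
  rw [rename_eq_subst, pderiv_subst (by simp), Finset.sum_eq_single i, rename_eq_subst]
  · simp
  · intro b _ hb
    simp [pderiv_X_of_ne (hg.ne hb)]
  · simp

theorem pderiv_rename_of_notMem {σ τ : Type*} [Finite σ] {g : σ → τ} {j : τ}
    (hj : j ∉ Set.range g) (f : MvPowerSeries σ ℂ) : pderiv ℂ j (rename g f) = 0 := by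
  have := Fintype.ofFinite σ
  rw [rename_eq_subst, pderiv_subst (by simp)]
  refine Finset.sum_eq_zero fun i _ => ?_
  have : g i ≠ j := fun h => hj ⟨i, h⟩
  simp [pderiv_X_of_ne this]

theorem killCompl_pderiv {σ τ : Type*} (e : σ ↪ τ) (i : σ) (f : MvPowerSeries τ ℂ) :
    killCompl e (pderiv ℂ (e i) f) = pderiv ℂ i (killCompl e f) := by
  ext d
  simp [coeff_killCompl, coeff_pderiv, Finsupp.embDomain_add, Finsupp.embDomain_single]

/-- The coefficient of `z ^ α` of a power series in two groups of variables `z, s`, as a power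
series in `s`. -/
def coeffInl {κ μ : Type*} (α : κ →₀ ℕ) (f : MvPowerSeries (κ ⊕ μ) ℂ) : MvPowerSeries μ ℂ :=
  fun β => coeff (Finsupp.sumElim α β) f

theorem coeff_coeffInl {κ μ : Type*} (α : κ →₀ ℕ) (β : μ →₀ ℕ) (f : MvPowerSeries (κ ⊕ μ) ℂ) :
    coeff β (coeffInl α f) = coeff (Finsupp.sumElim α β) f := rfl

theorem coeffInl_sum {κ μ ι : Type*} (α : κ →₀ ℕ) (s : Finset ι)
    (f : ι → MvPowerSeries (κ ⊕ μ) ℂ) :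
    coeffInl α (∑ i ∈ s, f i) = ∑ i ∈ s, coeffInl α (f i) := by
  ext β
  simp [coeff_coeffInl]

theorem coeffInl_zero_right {κ μ : Type*} (α : κ →₀ ℕ) :
    coeffInl α (0 : MvPowerSeries (κ ⊕ μ) ℂ) = 0 := by
  ext β
  simp [coeff_coeffInl]

theorem coeffInl_pderiv {κ μ : Type*} (α : κ →₀ ℕ) (j : μ) (f : MvPowerSeries (κ ⊕ μ) ℂ) :
    coeffInl α (pderiv ℂ (Sum.inr j) f) = pderiv ℂ j (coeffInl α f) := by
  classical
  ext β
  rw [coeff_coeffInl, coeff_pderiv, coeff_pderiv, coeff_coeffInl]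
  have : Finsupp.sumElim α β + Finsupp.single (Sum.inr j) 1 =
      Finsupp.sumElim α (β + Finsupp.single j 1) := by
    ext (i | i) <;> simp [Finsupp.single_apply]
  rw [this, Finsupp.sumElim_inr]

theorem embDomain_inr_eq_sumElim {κ μ : Type*} (β : μ →₀ ℕ) :
    Finsupp.embDomain Function.Embedding.inr β = Finsupp.sumElim (0 : κ →₀ ℕ) β := by
  ext (i | i)
  · rw [Finsupp.embDomain_of_notMem_range _ _ _ (by simp)]
    rfl
  · exact Finsupp.embDomain_apply_self Function.Embedding.inr β i

theorem coeffInl_zero {κ μ : Type*} (f : MvPowerSeries (κ ⊕ μ) ℂ) :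
    coeffInl 0 f = killCompl Function.Embedding.inr f := by
  ext β
  rw [coeff_killCompl, embDomain_inr_eq_sumElim, coeff_coeffInl]

theorem coeffInl_rename_mul {κ μ : Type*} [Finite μ] (α : κ →₀ ℕ) (a : MvPowerSeries μ ℂ)
    (f : MvPowerSeries (κ ⊕ μ) ℂ) :
    coeffInl α (rename Sum.inr a * f) = a * coeffInl α f := by
  classical
  ext β
  rw [coeff_coeffInl, coeff_mul, coeff_mul]
  symm
  -- A factor free of `z` contributes only through exponents with zero `z`-part, so the sum reduces
  -- to one over the antidiagonal of `β`.
  refine Finset.sum_of_injOn (fun x => (Finsupp.sumElim 0 x.1, Finsupp.sumElim α x.2)) ?_ ?_ ?_ ?_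
  · rintro ⟨x, y⟩ - ⟨x', y'⟩ - h
    obtain ⟨h1, h2⟩ := Prod.ext_iff.1 h
    refine Prod.ext ?_ ?_
    · ext i
      exact DFunLike.congr_fun h1 (Sum.inr i)
    · ext i
      exact DFunLike.congr_fun h2 (Sum.inr i)
  · rintro ⟨x, y⟩ h
    rw [Finset.mem_coe, Finset.HasAntidiagonal.mem_antidiagonal] at h ⊢
    rw [← h]
    ext (i | i) <;> simp
  · rintro ⟨x, y⟩ h hn
    rw [Finset.HasAntidiagonal.mem_antidiagonal] at h
    rw [coeff_rename_eq_zero, zero_mul]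
    rintro ⟨x', rfl⟩
    have hx : Finsupp.mapDomain (Sum.inr : μ → κ ⊕ μ) x' = Finsupp.sumElim 0 x' := by
      rw [← embDomain_inr_eq_sumElim, Finsupp.embDomain_eq_mapDomain]
      rfl
    refine hn ⟨(x', Finsupp.comapDomain Sum.inr y Sum.inr_injective.injOn), ?_, ?_⟩
    · rw [Finset.mem_coe, Finset.HasAntidiagonal.mem_antidiagonal]
      ext i
      simpa [hx] using DFunLike.congr_fun h (Sum.inr i)
    · refine Prod.ext hx.symm ?_
      ext (i | i)
      · simpa [hx] using (DFunLike.congr_fun h (Sum.inl i)).symm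
      · rfl
  · rintro ⟨x, y⟩ h
    have := coeff_embDomain_rename (Function.Embedding.inr : μ ↪ κ ⊕ μ) a x
    rw [embDomain_inr_eq_sumElim] at this
    rw [coeff_coeffInl]
    congr 1
    exact this.symm

/-! ### Matrices of full rank over a domain -/

/-- By rank-nullity the kernel has rank zero, and inside a torsion-free module this means that it
vanishes. The set of rows may be infinite. -/
theorem eq_zero_of_mulVec_eq_zero_of_rank {R ι : Type} [CommRing R] [IsDomain R] {n : ℕ}
    {A : Matrix ι (Fin n) R} (hA : A.rank = n) {a : Fin n → R} (ha : A.mulVec a = 0) : a = 0 := by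
  have h1 := LinearMap.rank_range_add_rank_ker A.mulVecLin
  have hn : Module.rank R (Fin n → R) = n := by simp
  have h2 : Module.rank R (LinearMap.range A.mulVecLin) = n := by
    have h3 := congrArg (Nat.cast (R := Cardinal)) hA
    rw [Matrix.rank, Module.finrank, Cardinal.cast_toNat_of_lt_aleph0] at h3
    · exact h3
    -- `Matrix.rank` truncates an infinite cardinal to zero; the range has rank at most `n`, so
    -- nothing is lost.
    refine lt_of_le_of_lt ?_ (Cardinal.natCast_lt_aleph0 (n := n))
    rw [← hn, ← h1]
    exact le_self_add
  rw [h2, hn] at h1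
  have h3 : Module.rank R (LinearMap.ker A.mulVecLin) = 0 :=
    Cardinal.eq_of_add_eq_add_left (h1.trans (add_zero _).symm) Cardinal.natCast_lt_aleph0
  rw [rank_zero_iff_forall_zero] at h3
  have := h3 ⟨a, by simpa using ha⟩
  simpa using this

theorem rank_eq_of_forall_mulVec_eq_zero {R : Type*} [CommRing R] [IsDomain R] {n : ℕ}
    {A : Matrix (Fin n) (Fin n) R} (hA : ∀ a, A.mulVec a = 0 → a = 0) : A.rank = n := by
  have : Function.Injective A.mulVecLin :=
    (injective_iff_map_eq_zero _).2 fun a ha => hA a (by simpa using ha)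
  rw [Matrix.rank, LinearMap.finrank_range_of_inj this, Module.finrank_fin_fun]

/-! ### Derivations along a family of Segre varieties -/

/-- The inclusion of the variables `(z, s)` into the variables `(z, w, s)`. -/
def graphEmbedding (n : ℕ) (κ : Type) : Fin n ⊕ κ ↪ Fin (n + 1) ⊕ κ :=
  ⟨Sum.map Fin.castSucc _root_.id, Sum.map_injective.2 ⟨Fin.castSucc_injective n, fun _ _ h => h⟩⟩

theorem range_graphEmbedding (n : ℕ) (κ : Type) :
    Set.range (graphEmbedding n κ) = {Sum.inl (Fin.last n)}ᶜ := by
  ext (i | i)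
  · induction i using Fin.lastCases with
    | last => simp [graphEmbedding, Fin.castSucc_ne_last]
    | cast i => simp [graphEmbedding, Fin.castSucc_ne_last]
  · simp [graphEmbedding]

/-- The parametrization `(z, s) ↦ (z, q(z, s), s)` of the graph `w = q(z, s)`. -/
def graphMap {n : ℕ} {κ : Type} (q : MvPowerSeries (Fin n ⊕ κ) ℂ) :
    Fin (n + 1) ⊕ κ → MvPowerSeries (Fin n ⊕ κ) ℂ :=
  Sum.elim (Fin.snoc (fun i => X (Sum.inl i)) q) (fun j => X (Sum.inr j))

theorem graphMap_graphEmbedding {n : ℕ} {κ : Type} (q : MvPowerSeries (Fin n ⊕ κ) ℂ)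
    (i : Fin n ⊕ κ) : graphMap q (graphEmbedding n κ i) = X i := by
  rcases i with i | i <;> simp [graphMap, graphEmbedding]

theorem graphMap_last {n : ℕ} {κ : Type} (q : MvPowerSeries (Fin n ⊕ κ) ℂ) :
    graphMap q (Sum.inl (Fin.last n)) = q := by
  simp [graphMap]

theorem constantCoeff_graphMap {n : ℕ} {κ : Type} {q : MvPowerSeries (Fin n ⊕ κ) ℂ}
    (hq : constantCoeff q = 0) (i : Fin (n + 1) ⊕ κ) : constantCoeff (graphMap q i) = 0 := by
  rcases i with i | i
  · induction i using Fin.lastCases with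
    | last => simp [graphMap, hq]
    | cast i => simp [graphMap]
  · simp [graphMap]

/-- The defining power series `w - q(z, s)` of a graph. -/
def graphEq {n : ℕ} {κ : Type} [Finite κ] (q : MvPowerSeries (Fin n ⊕ κ) ℂ) :
    MvPowerSeries (Fin (n + 1) ⊕ κ) ℂ :=
  X (Sum.inl (Fin.last n)) - rename (Sum.map Fin.castSucc _root_.id) q

theorem graphEq_dvd_iff {n : ℕ} {κ : Type} [Finite κ] {q : MvPowerSeries (Fin n ⊕ κ) ℂ}
    (hq : constantCoeff q = 0) {f : MvPowerSeries (Fin (n + 1) ⊕ κ) ℂ} :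
    graphEq q ∣ f ↔ subst (graphMap q) f = 0 :=
  X_sub_rename_dvd_iff (range_graphEmbedding n κ) hq (graphMap_graphEmbedding q) (graphMap_last q)

theorem prime_graphEq {n : ℕ} {κ : Type} [Finite κ] {q : MvPowerSeries (Fin n ⊕ κ) ℂ}
    (hq : constantCoeff q = 0) : Prime (graphEq q) :=
  prime_X_sub_rename (range_graphEmbedding n κ) hq (graphMap_graphEmbedding q) (graphMap_last q)

/-- A vector field in the parameters `s` that is tangent to the fibres of `η` is tangent to the
hypersurface `w = q(z, s)` as soon as the latter is contained in the zero set of a nonzero power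
series in `(z, w, η(s))`. -/
theorem sum_mul_pderiv_eq_zero {n m : ℕ} {κ : Type} [Fintype κ]
    {ρ : MvPowerSeries (Fin m ⊕ Fin m) ℂ} {k : Fin m → MvPowerSeries (Fin (n + 1)) ℂ}
    (hk : ∀ i, constantCoeff (k i) = 0) {η : Fin m → MvPowerSeries κ ℂ}
    (hη : ∀ i, constantCoeff (η i) = 0) {q : MvPowerSeries (Fin n ⊕ κ) ℂ}
    (hq : constantCoeff q = 0) {a : κ → MvPowerSeries κ ℂ}
    (ha : ∀ i, ∑ j, a j * pderiv ℂ j (η i) = 0)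
    (he : subst (Sum.elim (fun i => rename Sum.inl (k i)) fun i => rename Sum.inr (η i)) ρ ≠
      (0 : MvPowerSeries (Fin (n + 1) ⊕ κ) ℂ))
    (hdvd : graphEq q ∣
      subst (Sum.elim (fun i => rename Sum.inl (k i)) fun i => rename Sum.inr (η i)) ρ) :
    ∑ j, rename Sum.inr (a j) * pderiv ℂ (Sum.inr j) q = 0 := by
  set θ : Fin m ⊕ Fin m → MvPowerSeries (Fin (n + 1) ⊕ κ) ℂ :=
    Sum.elim (fun i => rename Sum.inl (k i)) fun i => rename Sum.inr (η i)
  have hθ : ∀ i, constantCoeff (θ i) = 0 := by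
    rintro (i | i) <;> simp [θ, hk, hη]
  set D : Derivation ℂ (MvPowerSeries (Fin (n + 1) ⊕ κ) ℂ) (MvPowerSeries (Fin (n + 1) ⊕ κ) ℂ) :=
    ∑ j : κ, (rename Sum.inr (a j) : MvPowerSeries (Fin (n + 1) ⊕ κ) ℂ) • pderiv ℂ (Sum.inr j)
  have hD : ∀ f, D f = ∑ j, rename Sum.inr (a j) * pderiv ℂ (Sum.inr j) f := by
    intro f
    have h := congrFun (map_sum Derivation.coeFnAddMonoidHom (fun j : κ =>
      (rename Sum.inr (a j) : MvPowerSeries (Fin (n + 1) ⊕ κ) ℂ) • pderiv ℂ (Sum.inr j))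
      Finset.univ) f
    rw [Finset.sum_apply] at h
    exact h
  have hDθ : ∀ i, D (θ i) = 0 := by
    intro i
    rw [hD]
    rcases i with i | i
    · refine Finset.sum_eq_zero fun j _ => ?_
      simp only [θ, Sum.elim_inl]
      rw [pderiv_rename_of_notMem (by simp), mul_zero]
    · simp only [θ, Sum.elim_inr, pderiv_rename Sum.inr_injective]
      simp only [← map_mul, ← map_sum, ha, map_zero]
  have hDe : D (subst θ ρ) = 0 := by
    rw [hD]
    simp only [pderiv_subst hθ, Finset.mul_sum]
    rw [Finset.sum_comm]
    refine Finset.sum_eq_zero fun i _ => ?_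
    rw [← mul_zero (subst θ (pderiv ℂ i ρ)), ← hDθ i, hD, Finset.mul_sum]
    exact Finset.sum_congr rfl fun j _ => by ring
  have hp : constantCoeff (graphEq q) = 0 := by simp [graphEq, hq]
  -- The multiple of `w - q` is nonzero and killed by `D`, so `w - q` divides `D(w - q)`. The latter
  -- does not involve `w`, and restriction to the graph leaves it unchanged.
  have h1 := prime_dvd_derivation D (prime_graphEq hq)
    (finiteMultiplicity_of_constantCoeff_zero hp he) hdvd hDe
  have h2 : D (graphEq q) = rename (graphEmbedding n κ)
      (-∑ j, rename Sum.inr (a j) * pderiv ℂ (Sum.inr j) q) := by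
    rw [hD, map_neg, map_sum, ← Finset.sum_neg_distrib]
    refine Finset.sum_congr rfl fun j _ => ?_
    rw [graphEq, map_sub, pderiv_X_of_ne (by simp), zero_sub, mul_neg, map_mul, rename_rename,
      ← pderiv_rename (graphEmbedding n κ).injective]
    rfl
  rw [h2, graphEq_dvd_iff hq, subst_rename (constantCoeff_graphMap hq)] at h1
  have h3 : graphMap q ∘ graphEmbedding n κ = X := funext (graphMap_graphEmbedding q)
  rw [h3, subst_self] at h1
  exact neg_eq_zero.1 h1

/-! ### The class `𝒞` -/

namespace FormalRealHypersurface

variable {n : ℕ} {M : FormalRealHypersurface (n + 1)} (c : NormalCoordinates M)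

theorem NormalCoordinates.constantCoeff_Q : constantCoeff c.Q = 0 := by
  have h := congrArg constantCoeff c.normal_z
  rw [constantCoeff_subst_of_zero, constantCoeff_X] at h
  · exact h
  · rintro (i | i) <;> simp

theorem NormalCoordinates.coeffInl_zero_Q : coeffInl 0 c.Q = X (Fin.last n) := by
  rw [coeffInl_zero, ← c.normal_z]
  refine (subst_eq_killCompl _ (fun i => rfl) (fun t ht => ?_) _).symm
  rcases t with t | t
  · rfl
  · exact absurd ⟨t, rfl⟩ ht

/-- The inclusion of the variables `(z, χ)` into the variables `(z, χ, τ)`. -/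
def chiEmbedding (n : ℕ) : Fin n ⊕ Fin n ↪ Fin n ⊕ Fin (n + 1) :=
  ⟨Sum.map _root_.id Fin.castSucc, Sum.map_injective.2 ⟨fun _ _ h => h, Fin.castSucc_injective n⟩⟩

/-- The power series `Q(z, χ, 0)`. -/
def NormalCoordinates.Qchi : MvPowerSeries (Fin n ⊕ Fin n) ℂ := killCompl (chiEmbedding n) c.Q

theorem NormalCoordinates.constantCoeff_Qchi : constantCoeff c.Qchi = 0 := by
  rw [← c.constantCoeff_Q, ← coeff_zero_eq_constantCoeff_apply,
    ← coeff_zero_eq_constantCoeff_apply, Qchi, coeff_killCompl, Finsupp.embDomain_zero]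

theorem embDomain_chiEmbedding (α β : Fin n →₀ ℕ) :
    Finsupp.embDomain (chiEmbedding n) (Finsupp.sumElim α β) =
      Finsupp.sumElim α (β.embDomain Fin.castSuccEmb) := by
  ext (i | i)
  · exact Finsupp.embDomain_apply_self (chiEmbedding n) _ (Sum.inl i)
  · rw [Finsupp.sumElim_inr]
    induction i using Fin.lastCases with
    | last =>
      rw [Finsupp.embDomain_of_notMem_range, Finsupp.embDomain_of_notMem_range]
      · simp
      · simp [chiEmbedding, Fin.castSucc_ne_last]
    | cast i =>
      exact (Finsupp.embDomain_apply_self (chiEmbedding n) _ (Sum.inr i)).trans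
        (Finsupp.embDomain_apply_self Fin.castSuccEmb β i).symm

theorem NormalCoordinates.coeffInl_Qchi (α : Fin n →₀ ℕ) :
    coeffInl α c.Qchi = killCompl Fin.castSuccEmb (coeffInl α c.Q) := by
  ext β
  rw [coeff_coeffInl, Qchi, coeff_killCompl, coeff_killCompl, coeff_coeffInl,
    embDomain_chiEmbedding]

theorem NormalCoordinates.QDeriv_eq (α : Fin n →₀ ℕ) :
    c.QDeriv α = ((∏ i, (α i).factorial : ℕ) : ℂ) • coeffInl α c.Qchi := by
  ext β
  rw [coeff_smul, c.coeffInl_Qchi, coeff_killCompl, coeff_coeffInl]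
  rfl

/-- The normal coordinates exhibit that `M` belongs to the class `𝒞`. -/
def NormalCoordinates.IsClassC : Prop :=
  ∃ k, genericRank (fun α : {α : Fin n →₀ ℕ // α.degree ≤ k} => c.QDeriv α.1) = n

variable {c}

theorem NormalCoordinates.IsClassC.eq_zero_of_coeffInl (hc : c.IsClassC)
    {a : Fin n → MvPowerSeries (Fin n) ℂ}
    (ha : ∀ α, ∑ j, a j * pderiv ℂ j (coeffInl α c.Qchi) = 0) : a = 0 := by
  obtain ⟨k, hk⟩ := hc
  refine eq_zero_of_mulVec_eq_zero_of_rank hk (funext fun α => ?_)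
  have h : ∀ j, pderiv ℂ j (c.QDeriv α.1) * a j = ((∏ i, (α.1 i).factorial : ℕ) : ℂ) •
      (a j * pderiv ℂ j (coeffInl α.1 c.Qchi)) := fun j => by
    rw [c.QDeriv_eq, Derivation.map_smul, smul_mul_assoc, mul_comm]
  calc _ = ∑ j, pderiv ℂ j (c.QDeriv α.1) * a j := rfl
    _ = 0 := by simp only [h, ← Finset.smul_sum, ha, smul_zero]

/-- The coefficients `a j` depend on `χ` alone, so expanding the relation in powers of `z` gives one
relation for each row of the class `𝒞` Jacobian matrix. -/
theorem NormalCoordinates.IsClassC.eq_zero_of_Qchi (hc : c.IsClassC)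
    {a : Fin n → MvPowerSeries (Fin n) ℂ}
    (ha : ∑ j, rename Sum.inr (a j) * pderiv ℂ (Sum.inr j) c.Qchi = 0) : a = 0 := by
  refine hc.eq_zero_of_coeffInl fun α => ?_
  have := congrArg (coeffInl α) ha
  rw [coeffInl_sum, coeffInl_zero_right] at this
  simpa only [coeffInl_rename_mul, coeffInl_pderiv] using this

/-- If `Q(z, χ, 0)` vanished, every vector field would kill it; with `n ≥ 1` there is a nonzero one.
-/
theorem NormalCoordinates.IsClassC.Qchi_ne_zero (hc : c.IsClassC) (hn : 1 ≤ n) : c.Qchi ≠ 0 := by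
  intro h
  have := hc.eq_zero_of_Qchi (a := fun _ => 1) (by simp [h])
  exact one_ne_zero (congrFun this ⟨0, hn⟩)

theorem range_castSuccEmb (n : ℕ) : Set.range (Fin.castSuccEmb (n := n)) = {Fin.last n}ᶜ := by
  ext i
  induction i using Fin.lastCases with
  | last => simp
  | cast i => simp [Fin.castSucc_ne_last]

/-- The class `𝒞` controls only `τ = 0`. Normality, `Q(0, χ, τ) = τ`, removes the `τ`-component; the
other components then vanish at `τ = 0`, and dividing by `τ` and repeating makes them divisible by
every power of `τ`. -/
theorem NormalCoordinates.IsClassC.eq_zero_of_Q (hc : c.IsClassC)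
    {a : Fin (n + 1) → MvPowerSeries (Fin (n + 1)) ℂ}
    (ha : ∑ j, rename Sum.inr (a j) * pderiv ℂ (Sum.inr j) c.Q = 0) : a = 0 := by
  have h1 : ∀ α, ∑ j, a j * pderiv ℂ j (coeffInl α c.Q) = 0 := by
    intro α
    have := congrArg (coeffInl α) ha
    rw [coeffInl_sum, coeffInl_zero_right] at this
    simpa only [coeffInl_rename_mul, coeffInl_pderiv] using this
  have h2 : a (Fin.last n) = 0 := by
    have := h1 0
    rw [c.coeffInl_zero_Q, Fin.sum_univ_castSucc, Finset.sum_eq_zero, zero_add,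
      pderiv_X_self, mul_one] at this
    · exact this
    · intro i _
      rw [pderiv_X_of_ne (Fin.castSucc_ne_last i).symm, mul_zero]
  have h3 : ∀ (m : ℕ) (j : Fin n), X (Fin.last n) ^ m ∣ a j.castSucc := by
    intro m
    induction m with
    | zero => simp
    | succ m ih =>
      choose b hb using ih
      have h4 : ∀ α, ∑ j, b j * pderiv ℂ j.castSucc (coeffInl α c.Q) = 0 := by
        intro α
        have := h1 α
        rw [Fin.sum_univ_castSucc, h2, zero_mul, add_zero] at this
        simp only [hb, mul_assoc, ← Finset.mul_sum] at this
        exact (mul_eq_zero.1 this).resolve_left (pow_ne_zero _ (X_prime _).ne_zero)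
      have h5 : (fun j => killCompl Fin.castSuccEmb (b j)) = 0 := by
        refine hc.eq_zero_of_coeffInl fun α => ?_
        have := congrArg (killCompl Fin.castSuccEmb) (h4 α)
        rw [map_sum, map_zero] at this
        rw [← this]
        refine Finset.sum_congr rfl fun j _ => ?_
        rw [map_mul, c.coeffInl_Qchi, ← killCompl_pderiv]
        rfl
      intro j
      rw [hb j, pow_succ]
      exact mul_dvd_mul_left _
        ((X_dvd_iff_killCompl (range_castSuccEmb n)).2 (congrFun h5 j))
  funext j
  induction j using Fin.lastCases with
  | last => exact h2
  | cast j =>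
    by_contra hj
    have := finiteMultiplicity_of_constantCoeff_zero (constantCoeff_X (Fin.last n)) hj
    rw [← not_not (a := FiniteMultiplicity _ _), FiniteMultiplicity.not_iff_forall] at this
    exact this fun m => h3 m j

end FormalRealHypersurface

/-! ### Conjugation of coefficients -/

/-- Conjugation of the coefficients of a formal power series. -/
abbrev conj {σ : Type*} : MvPowerSeries σ ℂ →+* MvPowerSeries σ ℂ :=
  MvPowerSeries.map (starRingEnd ℂ)

theorem conj_conj {σ : Type*} (f : MvPowerSeries σ ℂ) : conj (conj f) = f := by
  ext d
  simp

theorem conj_eq_zero {σ : Type*} {f : MvPowerSeries σ ℂ} : conj f = 0 ↔ f = 0 := by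
  constructor
  · intro h
    rw [← conj_conj f, h, map_zero]
  · rintro rfl
    exact map_zero _

theorem conj_pderiv {σ : Type*} (i : σ) (f : MvPowerSeries σ ℂ) :
    conj (pderiv ℂ i f) = pderiv ℂ i (conj f) := by
  ext d
  simp [coeff_pderiv]

theorem involution_mul {N : ℕ} (f g : MvPowerSeries (Fin N ⊕ Fin N) ℂ) :
    involution (f * g) = involution f * involution g := by
  simp [involution]

theorem subst_involution {N : ℕ} {σ : Type*} {a b : Fin N → MvPowerSeries σ ℂ}
    (ha : ∀ i, constantCoeff (a i) = 0) (hb : ∀ i, constantCoeff (b i) = 0)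
    (f : MvPowerSeries (Fin N ⊕ Fin N) ℂ) :
    subst (Sum.elim a b) (involution f) =
      conj (subst (Sum.elim (fun i => conj (b i)) fun i => conj (a i)) f) := by
  rw [involution, subst_rename (by rintro (i | i) <;> simp [ha, hb]), map_subst]
  · congr 1
    funext i
    rcases i with i | i <;> simp
  · exact hasSubst_of_constantCoeff_zero (by rintro (i | i) <;> simp [ha, hb])

theorem FormalMap.constantCoeff_complexify {k l : ℕ} (F : FormalMap k l) (i : Fin l ⊕ Fin l) :
    constantCoeff (F.complexify i) = 0 := by
  rcases i with i | i <;> simp [complexify, F.map_zero]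

theorem FormalMap.involution_subst_complexify {k l : ℕ} (F : FormalMap k l)
    (f : MvPowerSeries (Fin l ⊕ Fin l) ℂ) :
    involution (subst F.complexify f) = subst F.complexify (involution f) := by
  have h := F.constantCoeff_complexify
  have hF : F.complexify = Sum.elim (fun i => F.complexify (Sum.inl i))
      (fun i => F.complexify (Sum.inr i)) := by
    funext i
    rcases i with i | i <;> rfl
  conv_rhs => rw [hF]
  rw [subst_involution (fun i => h _) (fun i => h _), involution,
    map_subst (hasSubst_of_constantCoeff_zero h), rename_subst (by simp [h]),
    map_subst (hasSubst_of_constantCoeff_zero (by rintro (i | i) <;> simp [h]))]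
  congr 1
  funext i
  rcases i with i | i
  · simp only [complexify, Sum.elim_inl, Sum.elim_inr, rename_rename, ← rename_map, conj_conj]
    rfl
  · simp only [complexify, Sum.elim_inl, Sum.elim_inr, rename_rename, ← rename_map, conj_conj]
    rfl

theorem FormalMap.complexify_comp {k l m : ℕ} (G : FormalMap l m) (F : FormalMap k l)
    (i : Fin m ⊕ Fin m) : (G.comp F).complexify i = subst F.complexify (G.complexify i) := by
  rcases i with i | i
  · change rename Sum.inl (subst F.toFun (G.toFun i)) =
      subst F.complexify (rename Sum.inl (G.toFun i))
    rw [rename_subst F.map_zero, subst_rename F.constantCoeff_complexify]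
    rfl
  · change rename Sum.inr (conj (subst F.toFun (G.toFun i))) =
      subst F.complexify (rename Sum.inr (conj (G.toFun i)))
    rw [map_subst F.hasSubst, rename_subst (by simp [F.map_zero]),
      subst_rename F.constantCoeff_complexify]
    rfl

theorem FormalMap.subst_complexify_comp {k l m : ℕ} (G : FormalMap l m) (F : FormalMap k l)
    (f : MvPowerSeries (Fin m ⊕ Fin m) ℂ) :
    subst (G.comp F).complexify f = subst F.complexify (subst G.complexify f) := by
  rw [subst_comp_subst_apply (hasSubst_of_constantCoeff_zero G.constantCoeff_complexify)
    (hasSubst_of_constantCoeff_zero F.constantCoeff_complexify)]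
  congr 1
  funext i
  exact G.complexify_comp F i

theorem FormalMap.subst_elim_zero_complexify {k l : ℕ} (F : FormalMap k l) {σ : Type*}
    {a : Fin k → MvPowerSeries σ ℂ} (ha : ∀ i, constantCoeff (a i) = 0)
    (f : MvPowerSeries (Fin l ⊕ Fin l) ℂ) :
    subst (Sum.elim a 0) (subst F.complexify f) =
      subst (Sum.elim (fun i => subst a (F.toFun i)) 0) f := by
  have h : ∀ i, constantCoeff (Sum.elim a (0 : Fin k → MvPowerSeries σ ℂ) i) = 0 := by
    rintro (i | i) <;> simp [ha]
  rw [subst_comp_subst_apply (hasSubst_of_constantCoeff_zero F.constantCoeff_complexify)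
    (hasSubst_of_constantCoeff_zero h)]
  congr 1
  funext i
  rcases i with i | i
  · simp only [complexify, Sum.elim_inl]
    rw [subst_rename h]
    rfl
  · simp only [complexify, Sum.elim_inr, Pi.zero_apply]
    rw [subst_rename h, Sum.elim_comp_inr]
    exact subst_zero_of_constantCoeff_zero (by simp [F.map_zero])

theorem FormalMap.pderiv_inr_subst_complexify {k l : ℕ} (K : FormalMap k l) (j : Fin k)
    (f : MvPowerSeries (Fin l ⊕ Fin l) ℂ) :
    pderiv ℂ (Sum.inr j) (subst K.complexify f) = ∑ i, subst K.complexify (pderiv ℂ (Sum.inr i) f) *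
      rename Sum.inr (pderiv ℂ j (conj (K.toFun i))) := by
  rw [pderiv_subst K.constantCoeff_complexify, Fintype.sum_sum_type, Finset.sum_eq_zero, zero_add]
  · refine Finset.sum_congr rfl fun i _ => ?_
    rw [← pderiv_rename Sum.inr_injective]
    rfl
  · intro i _
    change _ * pderiv ℂ (Sum.inr j) (rename Sum.inl (K.toFun i)) = 0
    rw [pderiv_rename_of_notMem (by simp), mul_zero]

theorem subst_pderiv_mul_of_eq_zero {σ τ : Type*} [Finite σ] {a : σ → MvPowerSeries τ ℂ}
    (ha : ∀ i, constantCoeff (a i) = 0) {p : MvPowerSeries σ ℂ} (hp : subst a p = 0) (j : σ)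
    (b : MvPowerSeries σ ℂ) :
    subst a (pderiv ℂ j (b * p)) = subst a b * subst a (pderiv ℂ j p) := by
  have hs := hasSubst_of_constantCoeff_zero ha
  rw [Derivation.leibniz, smul_eq_mul, smul_eq_mul, subst_add hs, subst_mul hs, subst_mul hs, hp,
    zero_mul, add_zero]

/-! ### The Jacobian determinant and the transversal factor -/

namespace FormalRealHypersurface

theorem exists_pderiv_inr_ne_zero {N : ℕ} (M : FormalRealHypersurface N) :
    ∃ j : Fin N, constantCoeff (pderiv ℂ (Sum.inr j) M.r) ≠ 0 := by
  obtain ⟨j, hj⟩ := M.gradient_ne_zero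
  refine ⟨j, fun h => hj ?_⟩
  have h2 : pderiv ℂ (Sum.inr j) M.r = rename Sum.swap (conj (pderiv ℂ (Sum.inl j) M.r)) := by
    rw [conj_pderiv, ← pderiv_rename Sum.swap_leftInverse.injective]
    conv_lhs => rw [← M.invariant]
    rfl
  rw [h2] at h
  simpa using h

theorem r_ne_zero {N : ℕ} (M : FormalRealHypersurface N) : M.r ≠ 0 := by
  intro h
  obtain ⟨j, hj⟩ := M.gradient_ne_zero
  simp [h] at hj

variable {n : ℕ} {M M' : FormalRealHypersurface (n + 1)} (c : NormalCoordinates M)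

theorem NormalCoordinates.associated_graphEq :
    Associated (subst c.chart.complexify M.r) (graphEq c.Q) :=
  Ideal.span_singleton_eq_span_singleton.1 c.defining

variable {c}

/-- The determinant of the Jacobian matrix of the conjugate map `K̄`. -/
def conjJacobian (K : FormalMap (n + 1) (n + 1)) : MvPowerSeries (Fin (n + 1)) ℂ :=
  (Matrix.of fun i j => pderiv ℂ j (conj (K.toFun i))).det

/-- Over a domain a singular Jacobian matrix has a nonzero kernel vector, that is, a nonzero field
in `(χ, τ)` killing `K̄`. It would kill `Q`, against the class `𝒞`. The hypothesis at `ζ = 0`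
ensures that `ρ(K, K̄)` is nonzero. -/
theorem NormalCoordinates.IsClassC.conjJacobian_ne_zero (hc : c.IsClassC)
    {K : FormalMap (n + 1) (n + 1)} {ρ : MvPowerSeries (Fin (n + 1) ⊕ Fin (n + 1)) ℂ}
    (hK : graphEq c.Q ∣ subst K.complexify ρ) (hne : subst (Sum.elim K.toFun 0) ρ ≠ 0) :
    conjJacobian K ≠ 0 := by
  intro hJ
  obtain ⟨a, ha, hza⟩ := Matrix.exists_mulVec_eq_zero_iff.2 hJ
  refine ha (hc.eq_zero_of_Q ?_)
  refine sum_mul_pderiv_eq_zero (ρ := ρ) K.map_zero (η := fun i => conj (K.toFun i))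
    (by simp [K.map_zero]) c.constantCoeff_Q (fun i => ?_) ?_ hK
  · refine Eq.trans ?_ (congrFun hza i)
    exact Finset.sum_congr rfl fun j _ => mul_comm _ _
  · intro h
    apply hne
    have h2 := K.subst_elim_zero_complexify (a := X) constantCoeff_X ρ
    simp only [subst_self, id] at h2
    change subst (Sum.elim K.toFun 0) ρ = 0
    rw [← h2]
    have h3 : subst K.complexify ρ = 0 := h
    rw [h3, subst_zero_right (by rintro (i | i) <;> simp)]

/-- The transversal factor `A` divides, on `M`, the Jacobian determinant of `K̄` up to a unit. -/
theorem NormalCoordinates.exists_subst_graphMap_mul_eq {K : FormalMap (n + 1) (n + 1)}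
    {A : MvPowerSeries (Fin (n + 1) ⊕ Fin (n + 1)) ℂ}
    (hK : subst K.complexify M'.r = A * subst c.chart.complexify M.r) :
    ∃ y u, IsUnit u ∧ subst (graphMap c.Q) A * y = u * rename Sum.inr (conjJacobian K) := by
  obtain ⟨k, hk⟩ := M'.exists_pderiv_inr_ne_zero
  obtain ⟨v, hv⟩ := c.associated_graphEq.symm
  have hg := constantCoeff_graphMap c.constantCoeff_Q
  have hs := hasSubst_of_constantCoeff_zero hg
  have hgr : subst (graphMap c.Q) (graphEq c.Q) = 0 :=
    (graphEq_dvd_iff c.constantCoeff_Q).1 dvd_rfl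
  have hinr : ∀ f, subst (graphMap c.Q) (rename Sum.inr f) = rename Sum.inr f := by
    intro f
    rw [subst_rename hg, rename_eq_subst]
    rfl
  set m : Matrix (Fin (n + 1)) (Fin (n + 1)) (MvPowerSeries (Fin n ⊕ Fin (n + 1)) ℂ) :=
    Matrix.of fun i j => rename Sum.inr (pderiv ℂ j (conj (K.toFun i)))
  set ρ : Fin (n + 1) → MvPowerSeries (Fin n ⊕ Fin (n + 1)) ℂ := fun i =>
    subst (graphMap c.Q) (subst K.complexify (pderiv ℂ (Sum.inr i) M'.r))
  set w : Fin (n + 1) → MvPowerSeries (Fin n ⊕ Fin (n + 1)) ℂ := fun j =>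
    subst (graphMap c.Q) (v.1 * pderiv ℂ (Sum.inr j) (graphEq c.Q))
  have hdet : m.det = rename Sum.inr (conjJacobian K) := by
    rw [conjJacobian, AlgHom.map_det]
    rfl
  -- The `ζ`-derivatives of `hK` on the hypersurface, where the terms containing derivatives of `A`
  -- vanish.
  have hrow : ∀ j, subst (graphMap c.Q) A * w j = ∑ i, ρ i * m i j := by
    intro j
    have h := congrArg (fun f => subst (graphMap c.Q) (pderiv ℂ (Sum.inr j) f)) hK
    have h2 : A * subst c.chart.complexify M.r = (A * v) * graphEq c.Q := by rw [← hv]; ring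
    simp only [h2, subst_pderiv_mul_of_eq_zero hg hgr, subst_mul hs,
      FormalMap.pderiv_inr_subst_complexify] at h
    simp only [w, subst_mul hs, ← mul_assoc]
    rw [← h, ← coe_substAlgHom hs, map_sum]
    simp only [map_mul, coe_substAlgHom hs, hinr]
    rfl
  refine ⟨∑ j, w j * m.adjugate j k, ρ k, ?_, ?_⟩
  · refine isUnit_subst hg (isUnit_subst K.constantCoeff_complexify ?_)
    rw [isUnit_iff_constantCoeff, isUnit_iff_ne_zero]
    exact hk
  · rw [← hdet, Finset.mul_sum]
    -- Cramer's rule: the adjugate turns the rows into `J · ρ`, and the component `k` is chosen so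
    -- that `ρ k` is a unit.
    have h2 : Matrix.vecMul (Matrix.vecMul ρ m) m.adjugate = m.det • ρ := by
      rw [Matrix.vecMul_vecMul, Matrix.mul_adjugate, Matrix.vecMul_smul, Matrix.vecMul_one]
    have h3 := congrFun h2 k
    rw [Pi.smul_apply, smul_eq_mul, mul_comm] at h3
    rw [← h3]
    refine Finset.sum_congr rfl fun j _ => ?_
    rw [← mul_assoc, hrow]
    rfl

end FormalRealHypersurface

/-! ### Points of a hypersurface with values in `ℂ⟦t⟧` -/

/-- The property of having order exactly `k` is decided modulo `t ^ (k + 1)`. -/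
theorem associated_X_pow_of_dvd_sub {x y : MvPowerSeries Unit ℂ} {k : ℕ}
    (hx : Associated x (X () ^ k)) (h : X () ^ (k + 1) ∣ x - y) : Associated y (X () ^ k) := by
  obtain ⟨u, hu⟩ := hx.symm
  obtain ⟨g, hg⟩ := h
  have hy : y = X () ^ k * (u.1 - X () * g) := by
    rw [mul_sub, ← mul_assoc, ← pow_succ, ← hg, hu]
    ring
  rw [hy]
  refine associated_mul_unit_left _ _ ?_
  have := isUnit_iff_constantCoeff.1 u.isUnit
  rw [isUnit_iff_constantCoeff]
  simpa using this

theorem conj_dvd_conj {k : ℕ} {x : MvPowerSeries Unit ℂ} (h : X () ^ k ∣ x) :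
    X () ^ k ∣ conj x := by
  have := map_dvd (conj (σ := Unit)) h
  simpa using this

theorem conj_associated_X_pow {k : ℕ} {x : MvPowerSeries Unit ℂ} (h : Associated x (X () ^ k)) :
    Associated (conj x) (X () ^ k) := by
  have := h.map (conj (σ := Unit))
  simpa using this

namespace FormalRealHypersurface

variable {n : ℕ} {M M' : FormalRealHypersurface (n + 1)} (c : NormalCoordinates M)

/-- The point `(z, Q(z, ζ))` of the Segre variety of `ζ`. -/
def NormalCoordinates.segrePoint {σ : Type*} (z : Fin n → MvPowerSeries σ ℂ)
    (ζ : Fin (n + 1) → MvPowerSeries σ ℂ) : Fin (n + 1) → MvPowerSeries σ ℂ :=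
  Fin.snoc z (subst (Sum.elim z ζ) c.Q)

variable {c} {σ : Type*} {z : Fin n → MvPowerSeries σ ℂ} {Z ζ : Fin (n + 1) → MvPowerSeries σ ℂ}

theorem constantCoeff_elim {κ μ : Type*} {a : κ → MvPowerSeries σ ℂ} {b : μ → MvPowerSeries σ ℂ}
    (ha : ∀ i, constantCoeff (a i) = 0) (hb : ∀ i, constantCoeff (b i) = 0) (i : κ ⊕ μ) :
    constantCoeff (Sum.elim a b i) = 0 := by
  rcases i with i | i <;> simp [ha, hb]

theorem constantCoeff_snoc {w : MvPowerSeries σ ℂ} (hz : ∀ i, constantCoeff (z i) = 0)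
    (hw : constantCoeff w = 0) (i : Fin (n + 1)) :
    constantCoeff ((Fin.snoc z w : Fin (n + 1) → MvPowerSeries σ ℂ) i) = 0 := by
  induction i using Fin.lastCases with
  | last => simpa using hw
  | cast i => simpa using hz i

theorem NormalCoordinates.constantCoeff_segrePoint (hz : ∀ i, constantCoeff (z i) = 0)
    (hζ : ∀ i, constantCoeff (ζ i) = 0) (i : Fin (n + 1)) :
    constantCoeff (c.segrePoint z ζ i) = 0 := by
  refine constantCoeff_snoc hz ?_ i
  rw [constantCoeff_subst_of_zero (constantCoeff_elim hz hζ), c.constantCoeff_Q]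

theorem NormalCoordinates.subst_segrePoint_apply {τ : Type*} [Finite σ]
    {b : σ → MvPowerSeries τ ℂ} (hb : ∀ i, constantCoeff (b i) = 0)
    (hz : ∀ i, constantCoeff (z i) = 0) (hζ : ∀ i, constantCoeff (ζ i) = 0) :
    (fun i => subst b (c.segrePoint z ζ i)) =
      c.segrePoint (fun i => subst b (z i)) (fun i => subst b (ζ i)) := by
  funext i
  induction i using Fin.lastCases with
  | last =>
    simp only [segrePoint, Fin.snoc_last]
    rw [subst_comp_subst_apply (hasSubst_of_constantCoeff_zero (constantCoeff_elim hz hζ))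
      (hasSubst_of_constantCoeff_zero hb)]
    congr 1
    funext j
    rcases j with j | j <;> rfl
  | cast i => simp [segrePoint]

theorem NormalCoordinates.subst_segrePoint (hz : ∀ i, constantCoeff (z i) = 0)
    (hζ : ∀ i, constantCoeff (ζ i) = 0) (f : MvPowerSeries (Fin (n + 1) ⊕ Fin (n + 1)) ℂ) :
    subst (Sum.elim (c.segrePoint z ζ) ζ) f =
      subst (Sum.elim z ζ) (subst (graphMap c.Q) f) := by
  have hs := hasSubst_of_constantCoeff_zero (constantCoeff_elim hz hζ)
  rw [subst_comp_subst_apply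
    (hasSubst_of_constantCoeff_zero (constantCoeff_graphMap c.constantCoeff_Q)) hs]
  congr 1
  funext i
  rcases i with i | i
  · induction i using Fin.lastCases with
    | last => simp [segrePoint, graphMap]
    | cast i => simp [segrePoint, graphMap, subst_X hs]
  · simp [graphMap, subst_X hs]

theorem NormalCoordinates.subst_eq_zero_iff (hZ : ∀ i, constantCoeff (Z i) = 0)
    (hζ : ∀ i, constantCoeff (ζ i) = 0) :
    subst (Sum.elim Z ζ) (subst c.chart.complexify M.r) = 0 ↔
      Z = c.segrePoint (fun i => Z i.castSucc) ζ := by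
  have h := constantCoeff_elim hZ hζ
  have hs := hasSubst_of_constantCoeff_zero h
  obtain ⟨v, hv⟩ := c.associated_graphEq.symm
  rw [← hv, subst_mul hs, mul_eq_zero, or_iff_left (isUnit_subst h v.isUnit).ne_zero, graphEq,
    subst_sub hs, subst_X hs, subst_rename h, sub_eq_zero]
  have h2 : Sum.elim Z ζ ∘ Sum.map Fin.castSucc _root_.id =
      Sum.elim (fun i => Z i.castSucc) ζ := by
    funext i
    rcases i with i | i <;> rfl
  rw [h2]
  constructor
  · intro h3
    funext i
    induction i using Fin.lastCases with
    | last => simpa [segrePoint] using h3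
    | cast i => simp [segrePoint]
  · intro h3
    have := congrFun h3 (Fin.last n)
    simpa [segrePoint] using this

theorem NormalCoordinates.involution_subst_chart :
    involution (subst c.chart.complexify M.r) = subst c.chart.complexify M.r := by
  rw [FormalMap.involution_subst_complexify, M.invariant]

/-- The hypersurface is invariant under the involution. -/
theorem NormalCoordinates.conj_eq_segrePoint (hZ : ∀ i, constantCoeff (Z i) = 0)
    (hζ : ∀ i, constantCoeff (ζ i) = 0) (h : Z = c.segrePoint (fun i => Z i.castSucc) ζ) :
    (fun i => conj (ζ i)) =
      c.segrePoint (fun i => conj (ζ i.castSucc)) (fun i => conj (Z i)) := by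
  have hZ' : ∀ i, constantCoeff (conj (Z i)) = 0 := by simp [hZ]
  have hζ' : ∀ i, constantCoeff (conj (ζ i)) = 0 := by simp [hζ]
  rw [← NormalCoordinates.subst_eq_zero_iff hZ hζ, ← c.involution_subst_chart,
    subst_involution hZ hζ, conj_eq_zero, NormalCoordinates.subst_eq_zero_iff hζ' hZ'] at h
  exact h

theorem NormalCoordinates.segrePoint_zero (hζ : ∀ i, constantCoeff (ζ i) = 0) :
    c.segrePoint 0 ζ = Fin.snoc 0 (ζ (Fin.last n)) := by
  have hs := hasSubst_of_constantCoeff_zero hζ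
  rw [segrePoint]
  congr 1
  rw [← subst_X (R := ℂ) hs (Fin.last n), ← c.normal_z, subst_comp_subst_apply _ hs]
  · congr 1
    funext i
    rcases i with i | i
    · change 0 = subst ζ (0 : MvPowerSeries (Fin (n + 1)) ℂ)
      rw [subst_zero_right hζ]
    · simp [subst_X hs]
  · exact hasSubst_of_constantCoeff_zero (by rintro (i | i) <;> simp)

/-- The transversal factor along the curve `(z, w) = (0, w(t)) = (χ, τ)`. -/
def diagonal (A : MvPowerSeries (Fin (n + 1) ⊕ Fin (n + 1)) ℂ) (w : MvPowerSeries Unit ℂ) :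
    MvPowerSeries Unit ℂ :=
  subst (Sum.elim (Fin.snoc 0 w : Fin (n + 1) → MvPowerSeries Unit ℂ)
    (Fin.snoc 0 w : Fin (n + 1) → MvPowerSeries Unit ℂ)) A

/-! ### Orders of the transversal factor along curves in the hypersurface -/

section

variable {A : MvPowerSeries (Fin (n + 1) ⊕ Fin (n + 1)) ℂ} {J : MvPowerSeries (Fin (n + 1)) ℂ}
  {y u : MvPowerSeries (Fin n ⊕ Fin (n + 1)) ℂ} {z z' : Fin n → MvPowerSeries Unit ℂ}
  {Z ζ : Fin (n + 1) → MvPowerSeries Unit ℂ}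

/-- With `ζ` fixed, the points `(z, Q(z, ζ))` sweep out its Segre variety, along which `J(ζ)` is
constant; so the order of `A` is constant there too. -/
theorem NormalCoordinates.associated_subst_segrePoint (hu : IsUnit u)
    (h : subst (graphMap c.Q) A * y = u * rename Sum.inr J) (hζ : ∀ i, constantCoeff (ζ i) = 0)
    (hJ : subst ζ J ≠ 0) (hz : ∀ i, constantCoeff (z i) = 0) (hz' : ∀ i, constantCoeff (z' i) = 0) :
    Associated (subst (Sum.elim (c.segrePoint z ζ) ζ) A)
      (subst (Sum.elim (c.segrePoint z' ζ) ζ) A) := by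
  rw [c.subst_segrePoint hz hζ, c.subst_segrePoint hz' hζ]
  exact associated_subst_of_mul_eq hu h hζ hJ hz hz'

theorem NormalCoordinates.subst_segrePoint_ne_zero (hu : IsUnit u)
    (h : subst (graphMap c.Q) A * y = u * rename Sum.inr J) (hζ : ∀ i, constantCoeff (ζ i) = 0)
    (hJ : subst ζ J ≠ 0) (hz : ∀ i, constantCoeff (z i) = 0) :
    subst (Sum.elim (c.segrePoint z ζ) ζ) A ≠ 0 := by
  have hc := constantCoeff_elim hz hζ
  have hs := hasSubst_of_constantCoeff_zero hc
  have h2 := congrArg (subst (Sum.elim z ζ)) h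
  rw [subst_mul hs, subst_mul hs, subst_rename hc, Sum.elim_comp_inr] at h2
  rw [c.subst_segrePoint hz hζ]
  intro h0
  rw [h0, zero_mul, eq_comm, mul_eq_zero] at h2
  exact h2.elim (isUnit_subst hc hu).ne_zero hJ

/-- Along a generic curve `(z, w, χ, τ)` in `M` the order of the transversal factor depends
only on `w`. -/
theorem NormalCoordinates.associated_diagonal (hA : involution A = A) (hu : IsUnit u)
    (h : subst (graphMap c.Q) A * y = u * rename Sum.inr J) (hZ : ∀ i, constantCoeff (Z i) = 0)
    (hζ : ∀ i, constantCoeff (ζ i) = 0) (hM : Z = c.segrePoint (fun i => Z i.castSucc) ζ)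
    (hJ : subst ζ J ≠ 0) (hJ' : subst (fun i => conj (Z i)) J ≠ 0) :
    Associated (subst (Sum.elim Z ζ) A) (diagonal A (Z (Fin.last n))) := by
  have hA0 : subst (Sum.elim Z ζ) A ≠ 0 := by
    rw [hM]
    exact c.subst_segrePoint_ne_zero hu h hζ hJ fun i => hZ _
  obtain ⟨k, hk⟩ := associated_X_pow hA0
  have hconj : ∀ {Z ζ : Fin (n + 1) → MvPowerSeries Unit ℂ}, (∀ i, constantCoeff (Z i) = 0) →
      (∀ i, constantCoeff (ζ i) = 0) → subst (Sum.elim Z ζ) A =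
        conj (subst (Sum.elim (fun i => conj (ζ i)) fun i => conj (Z i)) A) := by
    intro Z ζ hZ hζ
    rw [← subst_involution hZ hζ, hA]
  set W : Fin (n + 1) → MvPowerSeries Unit ℂ := fun i => conj (Z i)
  have hW : ∀ i, constantCoeff (W i) = 0 := by simp [W, hZ]
  set χ₀ : Fin n → MvPowerSeries Unit ℂ := fun i => conj (ζ i.castSucc)
  have hχ₀ : ∀ i, constantCoeff (χ₀ i) = 0 := by simp [χ₀, hζ]
  have hM₀ : (fun i => conj (ζ i)) = c.segrePoint χ₀ W := c.conj_eq_segrePoint hZ hζ hM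
  have hJconj : ∀ {a : Fin (n + 1) → MvPowerSeries Unit ℂ}, (∀ i, constantCoeff (a i) = 0) →
      subst a (conj J) = conj (subst (fun i => conj (a i)) J) := by
    intro a ha
    rw [map_subst (hasSubst_of_constantCoeff_zero (by simp [ha]))]
    simp only [conj_conj]
  -- The Segre variety of `W = Z̄` with `χ` left free. The series `J̄` is nonzero on it, as seen at
  -- `χ₀`, so `χ` can be taken divisible by `t ^ (k + 1)` while `J` stays nonzero at the new point
  -- `ζ₁`.
  set θ : Fin (n + 1) → MvPowerSeries (Fin n ⊕ Unit) ℂ :=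
    c.segrePoint (fun i => X (Sum.inl i)) (fun i => rename Sum.inr (W i))
  have hX : ∀ i, constantCoeff (X (Sum.inl i) : MvPowerSeries (Fin n ⊕ Unit) ℂ) = 0 :=
    fun i => constantCoeff_X _
  have hrW : ∀ i, constantCoeff (rename (Sum.inr : Unit → Fin n ⊕ Unit) (W i)) = 0 := by
    simp [hW]
  have hθ : ∀ i, constantCoeff (θ i) = 0 := c.constantCoeff_segrePoint hX hrW
  have hθs : ∀ {χ : Fin n → MvPowerSeries Unit ℂ}, (∀ i, constantCoeff (χ i) = 0) →
      subst (Sum.elim χ fun _ => X ()) (subst θ (conj J)) =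
        subst (c.segrePoint χ W) (conj J) := by
    intro χ hχ
    have hc := constantCoeff_elim (μ := Unit) hχ (fun _ => constantCoeff_X ())
    have hs := hasSubst_of_constantCoeff_zero hc
    rw [subst_comp_subst_apply (hasSubst_of_constantCoeff_zero hθ) hs]
    have hr : ∀ i, subst (Sum.elim χ fun _ : Unit => X ()) (rename Sum.inr (W i)) = W i := by
      intro i
      rw [subst_rename hc, Sum.elim_comp_inr]
      change subst X (W i) = W i
      rw [subst_self, id]
    rw [c.subst_segrePoint_apply hc hX hrW]
    simp only [hr, subst_X hs, Sum.elim_inl]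
  have hg : subst θ (conj J) ≠ 0 := by
    intro h0
    have h1 := hθs hχ₀
    rw [h0, ← hM₀, hJconj (by simp [hζ]), subst_zero_right (constantCoeff_elim (μ := Unit) hχ₀
      (fun _ => constantCoeff_X ())), eq_comm, conj_eq_zero] at h1
    simp only [conj_conj] at h1
    exact hJ h1
  obtain ⟨χ, hχdvd, hχ⟩ := exists_curve_subst_ne_zero hg k
  have hχ0 : ∀ i, constantCoeff (χ i) = 0 := by
    intro i
    obtain ⟨g, hg⟩ := hχdvd i
    rw [hg]
    simp
  rw [hθs hχ0] at hχ
  set ζ₁ : Fin (n + 1) → MvPowerSeries Unit ℂ := fun i => conj (c.segrePoint χ W i)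
  have hS := c.constantCoeff_segrePoint hχ0 hW
  have hζ₁ : ∀ i, constantCoeff (ζ₁ i) = 0 := by simp [ζ₁, hS]
  have hJ₁ : subst ζ₁ J ≠ 0 := by
    intro h0
    rw [hJconj hS, conj_eq_zero.2 h0] at hχ
    exact hχ rfl
  have hcW : (fun i => conj (W i)) = Z := by
    funext i
    exact conj_conj _
  have hM₁ : Z = c.segrePoint (fun i => Z i.castSucc) ζ₁ := by
    have h1 := c.conj_eq_segrePoint hS hW (by simp [segrePoint])
    rw [hcW] at h1
    have hcW' : (fun i : Fin n => conj (W i.castSucc)) = fun i => Z i.castSucc := by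
      funext i
      exact conj_conj _
    rwa [hcW'] at h1
  -- First move: `Z` is kept and `χ` is changed. Reality of `A` interchanges the roles of `Z` and
  -- `ζ`.
  have h1 : Associated (subst (Sum.elim Z ζ₁) A) (X () ^ k) := by
    have h2 := c.associated_subst_segrePoint hu h hW hJ' hχ0 hχ₀
    rw [hconj hZ hζ₁]
    apply conj_associated_X_pow
    have h3 : (fun i => conj (ζ₁ i)) = c.segrePoint χ W := by
      funext i
      exact conj_conj _
    rw [h3]
    refine h2.trans ?_
    rw [← hM₀]
    have h4 := conj_associated_X_pow hk
    rwa [hconj hZ hζ, conj_conj] at h4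
  -- Second move: `ζ₁` is kept and `z` is set to zero. By normality the point reached is congruent
  -- to `(0, w, 0, w)` modulo `t ^ (k + 1)`, which preserves the order `k`.
  have h2 : Associated (subst (Sum.elim (c.segrePoint 0 ζ₁) ζ₁) A) (X () ^ k) := by
    refine Associated.trans ?_ h1
    conv_rhs => rw [hM₁]
    exact c.associated_subst_segrePoint hu h hζ₁ hJ₁ (by simp) (fun i => hZ _)
  have hlast : X () ^ (k + 1) ∣ ζ₁ (Fin.last n) - Z (Fin.last n) := by
    have h3 : ζ₁ (Fin.last n) - Z (Fin.last n) =
        conj (subst (Sum.elim χ W) c.Q - subst (Sum.elim 0 W) c.Q) := by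
      have h4 := congrFun (c.segrePoint_zero hW) (Fin.last n)
      simp only [segrePoint, Fin.snoc_last] at h4
      rw [h4, map_sub, conj_conj]
      simp [ζ₁, segrePoint]
    rw [h3]
    refine conj_dvd_conj (dvd_subst_sub_subst (constantCoeff_elim hχ0 hW)
      (constantCoeff_elim (by simp) hW) (fun i => ?_) _)
    rcases i with i | i
    · simpa using hχdvd i
    · simp
  have hcast : ∀ i : Fin n, X () ^ (k + 1) ∣ ζ₁ i.castSucc := by
    intro i
    have : ζ₁ i.castSucc = conj (χ i) := by simp [ζ₁, segrePoint]
    rw [this]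
    exact conj_dvd_conj (hχdvd i)
  refine hk.trans (associated_X_pow_of_dvd_sub h2 ?_).symm
  rw [c.segrePoint_zero hζ₁]
  have hz0 : ∀ i : Fin n, constantCoeff ((0 : Fin n → MvPowerSeries Unit ℂ) i) = 0 := by simp
  refine dvd_subst_sub_subst (constantCoeff_elim (constantCoeff_snoc hz0 (hζ₁ _)) hζ₁)
    (constantCoeff_elim (constantCoeff_snoc hz0 (hZ _)) (constantCoeff_snoc hz0 (hZ _)))
    (fun i => ?_) _
  rcases i with i | i
  · induction i using Fin.lastCases with
    | last => simpa using hlast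
    | cast i => simp
  · induction i using Fin.lastCases with
    | last => simpa using hlast
    | cast i => simpa using hcast i

end

end FormalRealHypersurface

/-! ### The transversal factor is a unit -/

namespace FormalRealHypersurface

variable {n : ℕ} {M M' : FormalRealHypersurface (n + 1)} {c : NormalCoordinates M}

/-- The diagonal values come from a single series in one variable, so their order is a fixed
multiple `s` of the order of `w`. -/
theorem diagonal_eq_subst (A : MvPowerSeries (Fin (n + 1) ⊕ Fin (n + 1)) ℂ)
    {w : MvPowerSeries Unit ℂ} (hw : constantCoeff w = 0) :
    diagonal A w = subst (fun _ => w) (diagonal A (X ())) := by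
  have hs : HasSubst (fun _ : Unit => w) := hasSubst_of_constantCoeff_zero fun _ => hw
  have hz0 : ∀ i : Fin n, constantCoeff ((0 : Fin n → MvPowerSeries Unit ℂ) i) = 0 := by simp
  have hX := constantCoeff_snoc hz0 (constantCoeff_X (R := ℂ) ())
  rw [diagonal, diagonal, subst_comp_subst_apply
    (hasSubst_of_constantCoeff_zero (constantCoeff_elim hX hX)) hs]
  have h : ∀ i : Fin (n + 1), (Fin.snoc 0 w : Fin (n + 1) → MvPowerSeries Unit ℂ) i =
      subst (fun _ => w) ((Fin.snoc 0 (X ()) : Fin (n + 1) → MvPowerSeries Unit ℂ) i) := by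
    intro i
    induction i using Fin.lastCases with
    | last => simp [subst_X hs]
    | cast i => simp [subst_zero_right (a := fun _ : Unit => w) (fun _ => hw)]
  congr 1
  funext i
  rcases i with i | i
  · exact h i
  · exact h i

theorem NormalCoordinates.subst_Q_snoc_zero {σ : Type*} {z χ : Fin n → MvPowerSeries σ ℂ}
    (hz : ∀ i, constantCoeff (z i) = 0) (hχ : ∀ i, constantCoeff (χ i) = 0) :
    subst (Sum.elim z (Fin.snoc χ 0 : Fin (n + 1) → MvPowerSeries σ ℂ)) c.Q =
      subst (Sum.elim z χ) c.Qchi := by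
  have hs := hasSubst_of_constantCoeff_zero (constantCoeff_elim hz hχ)
  set a : Fin n ⊕ Fin (n + 1) → MvPowerSeries (Fin n ⊕ Fin n) ℂ :=
    Sum.elim (fun i => X (Sum.inl i)) (Fin.snoc (fun i => X (Sum.inr i)) 0)
  have h1 : ∀ i, a (chiEmbedding n i) = X i := by
    rintro (i | i) <;> simp [a, chiEmbedding]
  have h2 : ∀ i ∉ Set.range (chiEmbedding n), a i = 0 := by
    rintro (i | i) hi
    · exact absurd ⟨Sum.inl i, rfl⟩ hi
    · induction i using Fin.lastCases with
      | last => simp [a]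
      | cast i => exact absurd ⟨Sum.inr i, rfl⟩ hi
  rw [Qchi, ← subst_eq_killCompl _ h1 h2, subst_comp_subst_apply _ hs]
  · congr 1
    funext i
    rcases i with i | i
    · simp [a, subst_X hs]
    · induction i using Fin.lastCases with
      | last => simp [a, subst_zero_right (constantCoeff_elim hz hχ)]
      | cast i => simp [a, subst_X hs]
  · refine hasSubst_of_constantCoeff_zero
      (constantCoeff_elim (by simp) (constantCoeff_snoc (by simp) (by simp)))

/-- At `χ = 0` the point `(z, Q(z, 0, τ))` is `(z, τ)`, by normality, so `f` is recovered. -/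
theorem NormalCoordinates.subst_segrePoint_X_ne_zero {f : MvPowerSeries (Fin (n + 1)) ℂ}
    (hf : f ≠ 0) : subst (c.segrePoint (fun i => X (Sum.inl i)) (fun i => X (Sum.inr i)) :
      Fin (n + 1) → MvPowerSeries (Fin n ⊕ Fin (n + 1)) ℂ) f ≠ 0 := by
  classical
  intro h0
  set a : Fin n ⊕ Fin (n + 1) → MvPowerSeries (Fin (n + 1)) ℂ :=
    Sum.elim (fun i => X i.castSucc) (Pi.single (Fin.last n) (X (Fin.last n)))
  have ha : ∀ i, constantCoeff (a i) = 0 := by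
    rintro (i | i)
    · simp [a]
    · simp only [a, Sum.elim_inr, Pi.single_apply]
      split_ifs <;> simp
  have hs := hasSubst_of_constantCoeff_zero ha
  have h := congrArg (subst a) h0
  have hX1 : ∀ i, constantCoeff (X (Sum.inl i) : MvPowerSeries (Fin n ⊕ Fin (n + 1)) ℂ) = 0 :=
    fun i => constantCoeff_X _
  have hX2 : ∀ i, constantCoeff (X (Sum.inr i) : MvPowerSeries (Fin n ⊕ Fin (n + 1)) ℂ) = 0 :=
    fun i => constantCoeff_X _
  rw [subst_zero_right ha, subst_comp_subst_apply
    (hasSubst_of_constantCoeff_zero (c.constantCoeff_segrePoint hX1 hX2)) hs,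
    c.subst_segrePoint_apply ha hX1 hX2] at h
  have h1 : c.segrePoint (fun i => subst a (X (Sum.inl i) : MvPowerSeries _ ℂ))
      (fun i => subst a (X (Sum.inr i) : MvPowerSeries _ ℂ)) = X := by
    funext i
    simp only [segrePoint, subst_X hs]
    induction i using Fin.lastCases with
    | last =>
      rw [Fin.snoc_last, ← c.normal_chi]
      congr 1
    | cast i => simp [a]
  rw [h1, subst_self] at h
  exact hf h

/-- If the transversal factor `A` divides on `M` a nonzero power series in `(χ, τ)`, then it is
a unit. -/
theorem NormalCoordinates.IsClassC.constantCoeff_ne_zero (hc : c.IsClassC) (hn : 1 ≤ n)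
    {A : MvPowerSeries (Fin (n + 1) ⊕ Fin (n + 1)) ℂ} (hA : involution A = A)
    {J : MvPowerSeries (Fin (n + 1)) ℂ} (hJ : J ≠ 0)
    {y u : MvPowerSeries (Fin n ⊕ Fin (n + 1)) ℂ} (hu : IsUnit u)
    (h : subst (graphMap c.Q) A * y = u * rename Sum.inr J) : constantCoeff A ≠ 0 := by
  have hJc : conj J ≠ 0 := fun h0 => hJ (conj_eq_zero.1 h0)
  set S : Fin (n + 1) → MvPowerSeries (Fin n ⊕ Fin (n + 1)) ℂ :=
    c.segrePoint (fun i => X (Sum.inl i)) (fun i => X (Sum.inr i))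
  have hX1 : ∀ i, constantCoeff (X (Sum.inl i) : MvPowerSeries (Fin n ⊕ Fin (n + 1)) ℂ) = 0 :=
    fun i => constantCoeff_X _
  have hX2 : ∀ i, constantCoeff (X (Sum.inr i) : MvPowerSeries (Fin n ⊕ Fin (n + 1)) ℂ) = 0 :=
    fun i => constantCoeff_X _
  have hS := c.constantCoeff_segrePoint hX1 hX2
  have hP : rename Sum.inr J * subst S (conj J) * rename (chiEmbedding n) c.Qchi ≠ 0 := by
    refine mul_ne_zero (mul_ne_zero ?_ (c.subst_segrePoint_X_ne_zero hJc)) ?_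
    · exact (map_ne_zero_iff _ (rename_injective Function.Embedding.inr)).2 hJ
    · exact (map_ne_zero_iff _ (rename_injective (chiEmbedding n))).2 (hc.Qchi_ne_zero hn)
  -- A dummy variable is adjoined to serve as the parameter of the curve; the exponent `0` only asks
  -- that the curve pass through the origin.
  obtain ⟨p, hpdvd, hp⟩ := exists_curve_subst_ne_zero
    ((map_ne_zero_iff _ (rename_injective (Function.Embedding.inl (β := Unit)))).2 hP) 0
  have hp0 : ∀ i, constantCoeff (p i) = 0 := by
    intro i
    obtain ⟨g, hg⟩ := hpdvd i
    rw [hg]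
    simp
  have hps := hasSubst_of_constantCoeff_zero hp0
  have hp' : subst p (rename Sum.inr J * subst S (conj J) * rename (chiEmbedding n) c.Qchi) ≠ 0 := by
    intro h0
    refine hp ?_
    have := subst_rename (constantCoeff_elim hp0 (fun _ : Unit => constantCoeff_X ()))
      (Function.Embedding.inl (β := Unit))
      (rename Sum.inr J * subst S (conj J) * rename (chiEmbedding n) c.Qchi)
    exact this.trans h0
  rw [subst_mul hps, subst_mul hps, mul_ne_zero_iff, mul_ne_zero_iff, subst_rename hp0,
    subst_rename hp0, subst_comp_subst_apply (hasSubst_of_constantCoeff_zero hS) hps,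
    c.subst_segrePoint_apply hp0 hX1 hX2] at hp'
  simp only [subst_X hps] at hp'
  set δ : Fin n → MvPowerSeries Unit ℂ := fun i => p (Sum.inl i)
  set χ : Fin n → MvPowerSeries Unit ℂ := fun i => p (Sum.inr i.castSucc)
  have hδ : ∀ i, constantCoeff (δ i) = 0 := fun i => hp0 _
  have hχ : ∀ i, constantCoeff (χ i) = 0 := fun i => hp0 _
  have hpχ : (p ∘ chiEmbedding n) = Sum.elim δ χ := by
    funext i
    rcases i with i | i <;> rfl
  have hpr : (fun i => p (Sum.inr i)) = Fin.snoc χ (p (Sum.inr (Fin.last n))) := by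
    funext i
    induction i using Fin.lastCases with
    | last => simp
    | cast i => simp [χ]
  obtain ⟨⟨hp1, hp2⟩, hp3⟩ := hp'
  rw [hpχ] at hp3
  change subst (fun i => p (Sum.inr i)) J ≠ 0 at hp1
  rw [hpr] at hp1 hp2
  obtain ⟨l, hl⟩ := associated_X_pow hp3
  set δX : Fin n → MvPowerSeries (Unit ⊕ Unit) ℂ := fun i => rename Sum.inr (δ i)
  set ζX : Fin (n + 1) → MvPowerSeries (Unit ⊕ Unit) ℂ :=
    Fin.snoc (fun i => rename Sum.inr (χ i)) (X (Sum.inl ()))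
  have hδX : ∀ i, constantCoeff (δX i) = 0 := by simp [δX, hδ]
  have hζX : ∀ i, constantCoeff (ζX i) = 0 := constantCoeff_snoc (by simp [hχ]) (by simp)
  have hSX := c.constantCoeff_segrePoint hδX hζX
  set g := subst ζX J * subst (c.segrePoint δX ζX) (conj J)
  have hgs : ∀ {τ : Unit → MvPowerSeries Unit ℂ}, (∀ i, constantCoeff (τ i) = 0) →
      subst (Sum.elim τ fun _ => X ()) g = subst (Fin.snoc χ (τ ())) J *
        subst (c.segrePoint δ (Fin.snoc χ (τ ()))) (conj J) := by
    intro τ hτ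
    have hcb := constantCoeff_elim (μ := Unit) hτ (fun _ => constantCoeff_X ())
    have hs := hasSubst_of_constantCoeff_zero hcb
    have hr : ∀ f, subst (Sum.elim τ fun _ : Unit => X ()) (rename Sum.inr f) = f := by
      intro f
      rw [subst_rename hcb, Sum.elim_comp_inr]
      change subst X f = f
      rw [subst_self, id]
    have hζ : (fun i => subst (Sum.elim τ fun _ => X ()) (ζX i)) = Fin.snoc χ (τ ()) := by
      funext i
      induction i using Fin.lastCases with
      | last => simp [ζX, subst_X hs]
      | cast i => simp [ζX, hr]
    simp only [g]
    rw [subst_mul hs, subst_comp_subst_apply (hasSubst_of_constantCoeff_zero hζX) hs,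
      subst_comp_subst_apply (hasSubst_of_constantCoeff_zero hSX) hs,
      c.subst_segrePoint_apply hcb hδX hζX, hζ]
    simp only [δX, hr]
  have hg : g ≠ 0 := by
    intro h0
    have h1 := hgs (τ := fun _ => p (Sum.inr (Fin.last n))) (fun _ => hp0 _)
    rw [h0, subst_zero_right (constantCoeff_elim (μ := Unit) (fun _ => hp0 _)
      (fun _ => constantCoeff_X ())), eq_comm, mul_eq_zero] at h1
    exact h1.elim hp1 hp2
  -- With `δ` and `χ` kept, `τ` is replaced by a series of order at least `l + 1`, where `l` is the
  -- order of `Q(δ, χ, 0)`. Then `w = Q(δ, χ, τ)` still has order `l`, and `J` remains nonzero at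
  -- both ends.
  obtain ⟨τ', hτdvd, hτ⟩ := exists_curve_subst_ne_zero hg l
  set τ := τ' ()
  have hτ0 : constantCoeff τ = 0 := by
    obtain ⟨g, hg⟩ := hτdvd ()
    simp [τ, hg]
  rw [hgs (fun _ => hτ0), mul_ne_zero_iff] at hτ
  set ζ : Fin (n + 1) → MvPowerSeries Unit ℂ := Fin.snoc χ τ
  have hζ : ∀ i, constantCoeff (ζ i) = 0 := constantCoeff_snoc hχ hτ0
  set Z := c.segrePoint δ ζ
  have hZ : ∀ i, constantCoeff (Z i) = 0 := c.constantCoeff_segrePoint hδ hζ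
  have hM : Z = c.segrePoint (fun i => Z i.castSucc) ζ := by simp [Z, segrePoint]
  have hw : Associated (Z (Fin.last n)) (X () ^ l) := by
    refine associated_X_pow_of_dvd_sub hl ?_
    rw [← c.subst_Q_snoc_zero hδ hχ]
    simp only [Z, segrePoint, Fin.snoc_last]
    refine dvd_subst_sub_subst (constantCoeff_elim hδ (constantCoeff_snoc hχ (by simp)))
      (constantCoeff_elim hδ hζ) (fun i => ?_) _
    rcases i with i | i
    · simp
    · induction i using Fin.lastCases with
      | last => simpa [ζ] using hτdvd ()
      | cast i => simp [ζ]
  have hJZ : subst (fun i => conj (Z i)) J ≠ 0 := by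
    intro h0
    refine hτ.2 ?_
    rw [← conj_eq_zero, map_subst (hasSubst_of_constantCoeff_zero hZ), conj_conj, h0]
  have hA1 := c.associated_diagonal hA hu h hZ hζ hM hτ.1 hJZ
  have hcζ : ∀ i, constantCoeff (conj (ζ i)) = 0 := by simp [hζ]
  have hcZ : ∀ i, constantCoeff (conj (Z i)) = 0 := by simp [hZ]
  have hA2 := c.associated_diagonal (Z := fun i => conj (ζ i)) (ζ := fun i => conj (Z i)) hA hu h
    hcζ hcZ (c.conj_eq_segrePoint hZ hζ hM) hJZ (by simpa only [conj_conj] using hτ.1)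
  have hA0 : subst (Sum.elim Z ζ) A ≠ 0 := c.subst_segrePoint_ne_zero hu h hζ hτ.1 hδ
  have hα : diagonal A (X ()) ≠ 0 := by
    intro h0
    rw [diagonal_eq_subst A (hZ _), h0, subst_zero_right (fun _ : Unit => hZ _)] at hA1
    exact hA0 ((associated_zero_iff_eq_zero _).1 hA1)
  obtain ⟨s, hs⟩ := associated_X_pow hα
  have hdiag : ∀ {w : MvPowerSeries Unit ℂ}, constantCoeff w = 0 →
      Associated (diagonal A w) (w ^ s) := by
    intro w hw
    have hsw : HasSubst (fun _ : Unit => w) := hasSubst_of_constantCoeff_zero fun _ => hw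
    rw [diagonal_eq_subst A hw]
    have := hs.map (substAlgHom (S := ℂ) hsw)
    rw [map_pow, coe_substAlgHom, subst_X hsw] at this
    exact this
  have h1 : Associated (subst (Sum.elim Z ζ) A) (X () ^ (l * s)) := by
    rw [pow_mul]
    exact (hA1.trans (hdiag (hZ _))).trans hw.pow_pow
  have h2 : Associated (conj τ ^ s) (X () ^ (l * s)) := by
    have h3 := conj_associated_X_pow h1
    rw [← hA, subst_involution hZ hζ, conj_conj] at h3
    have h4 := hdiag (hcζ (Fin.last n))
    have h5 : ζ (Fin.last n) = τ := by simp [ζ]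
    rw [h5] at h4
    refine h4.symm.trans (Associated.trans ?_ h3)
    rw [← h5]
    exact hA2.symm
  -- The order of `A` is `l * s` when read through `w` and at least `(l + 1) * s` when read through
  -- `τ`, which forces `s = 0`.
  have h3 : (X () : MvPowerSeries Unit ℂ) ^ ((l + 1) * s) ∣ X () ^ (l * s) := by
    rw [pow_mul]
    exact (pow_dvd_pow_of_dvd (conj_dvd_conj (hτdvd ())) s).trans h2.dvd
  have h4 := (pow_dvd_pow_iff (X_prime ()).ne_zero (X_prime ()).not_isUnit).1 h3
  have hs0 : s = 0 := by
    rw [add_mul, one_mul] at h4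
    omega
  rw [hs0, pow_zero, associated_one_iff_isUnit, isUnit_iff_constantCoeff, isUnit_iff_ne_zero,
    diagonal, constantCoeff_subst_of_zero] at hs
  · exact hs
  · exact constantCoeff_elim (constantCoeff_snoc (by simp) (by simp))
      (constantCoeff_snoc (by simp) (by simp))

end FormalRealHypersurface

/-! ### Composition of formal maps -/

namespace FormalMap

theorem ext_toFun {k l : ℕ} {F G : FormalMap k l} (h : ∀ i, F.toFun i = G.toFun i) : F = G := by
  cases F
  cases G
  congr
  funext i
  exact h i

theorem comp_assoc {k l m p : ℕ} (K : FormalMap m p) (G : FormalMap l m) (F : FormalMap k l) :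
    (K.comp G).comp F = K.comp (G.comp F) :=
  ext_toFun fun i => subst_comp_subst_apply G.hasSubst F.hasSubst (K.toFun i)

theorem id_comp {k l : ℕ} (F : FormalMap k l) : (FormalMap.id l).comp F = F :=
  ext_toFun fun i => subst_X F.hasSubst i

/-- The derivative of a formal map along the formal vector field with the components `a`. -/
def derivAlong {k l : ℕ} (a : Fin k → MvPowerSeries (Fin k) ℂ) (F : FormalMap k l) (i : Fin l) :
    MvPowerSeries (Fin k) ℂ :=
  ∑ j, a j * pderiv ℂ j (F.toFun i)

theorem derivAlong_id {k : ℕ} (a : Fin k → MvPowerSeries (Fin k) ℂ) :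
    derivAlong a (FormalMap.id k) = a := by
  funext i
  rw [derivAlong, Finset.sum_eq_single i]
  · simp [FormalMap.id]
  · intro j _ hj
    rw [FormalMap.id, pderiv_X_of_ne hj.symm, mul_zero]
  · simp

theorem derivAlong_comp {k l m : ℕ} (a : Fin k → MvPowerSeries (Fin k) ℂ) (G : FormalMap l m)
    (F : FormalMap k l) (i : Fin m) :
    derivAlong a (G.comp F) i =
      ∑ p, subst F.toFun (pderiv ℂ p (G.toFun i)) * derivAlong a F p := by
  simp only [derivAlong, comp, pderiv_subst F.map_zero, Finset.mul_sum]
  rw [Finset.sum_comm]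
  exact Finset.sum_congr rfl fun _ _ => Finset.sum_congr rfl fun _ _ => by ring

theorem derivAlong_comp_eq_zero {k l m : ℕ} {a : Fin k → MvPowerSeries (Fin k) ℂ}
    {F : FormalMap k l} (h : derivAlong a F = 0) (G : FormalMap l m) :
    derivAlong a (G.comp F) = 0 := by
  funext i
  rw [derivAlong_comp]
  exact Finset.sum_eq_zero fun p _ => by rw [h, Pi.zero_apply, mul_zero]

/-- If no vector field is killed by `G`, the same holds after composition with an invertible
map. -/
theorem eq_zero_of_derivAlong_comp {k m : ℕ} {G : FormalMap k m} {φ ψ : FormalMap k k}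
    (hφψ : φ.comp ψ = FormalMap.id k) (hψφ : ψ.comp φ = FormalMap.id k)
    (hG : ∀ b, derivAlong b G = 0 → b = 0) {a : Fin k → MvPowerSeries (Fin k) ℂ}
    (ha : derivAlong a (G.comp φ) = 0) : a = 0 := by
  have hψ := ψ.hasSubst
  have hφ := φ.hasSubst
  have hinv : ∀ {α β : FormalMap k k}, α.comp β = FormalMap.id k → ∀ f : MvPowerSeries (Fin k) ℂ,
      subst β.toFun (subst α.toFun f) = f := by
    intro α β h f
    rw [subst_comp_subst_apply α.hasSubst β.hasSubst]
    have h2 : (fun i => subst β.toFun (α.toFun i)) = X := congrArg toFun h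
    rw [h2, subst_self, id_eq]
  -- This is the push-forward of the field `a` under `φ`; it kills `G`.
  have hb : (fun p => subst ψ.toFun (derivAlong a φ p)) = 0 := by
    refine hG _ (funext fun i => ?_)
    have h := congrArg (subst ψ.toFun) (congrFun ha i)
    rw [derivAlong_comp, Pi.zero_apply, subst_zero_right ψ.map_zero, ← coe_substAlgHom hψ,
      map_sum] at h
    simp only [map_mul] at h
    simp only [coe_substAlgHom, hinv hφψ] at h
    rw [Pi.zero_apply, ← h]
    exact Finset.sum_congr rfl fun p _ => mul_comm _ _
  have hφ0 : derivAlong a φ = 0 := by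
    funext p
    rw [← hinv hψφ (derivAlong a φ p), congrFun hb p, Pi.zero_apply,
      subst_zero_right φ.map_zero]
  rw [← derivAlong_id a, ← hψφ]
  exact derivAlong_comp_eq_zero hφ0 ψ

/-- The inclusion `z ↦ (z, 0)`. -/
def segreInclusion (n : ℕ) : FormalMap n (n + 1) where
  toFun := Fin.snoc (fun l => X l) 0
  map_zero := fun i => by
    induction i using Fin.lastCases <;> simp

/-- The projection `(z, w) ↦ z`. -/
def tangentialProjection (n : ℕ) : FormalMap (n + 1) n where
  toFun := fun i => X i.castSucc
  map_zero := fun _ => constantCoeff_X _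

theorem tangentialProjection_comp_segreInclusion (n : ℕ) :
    (tangentialProjection n).comp (segreInclusion n) = FormalMap.id n :=
  ext_toFun fun i => by
    change subst (segreInclusion n).toFun (X i.castSucc) = X i
    rw [subst_X (segreInclusion n).hasSubst]
    simp [segreInclusion]

/-- The map `z ↦ F(z, 0)`, where `F` consists of the tangential components. -/
def tangential {n : ℕ} (F : FormalMap (n + 1) (n + 1)) : FormalMap n n :=
  (tangentialProjection n).comp (F.comp (segreInclusion n))

theorem tangential_toFun {n : ℕ} (F : FormalMap (n + 1) (n + 1)) (i : Fin n) :
    (tangential F).toFun i = subst (segreInclusion n).toFun (F.toFun i.castSucc) :=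
  subst_X (F.comp (segreInclusion n)).hasSubst i.castSucc

theorem segreInclusion_comp_tangential {n : ℕ} {F : FormalMap (n + 1) (n + 1)}
    (hF : subst (segreInclusion n).toFun (F.toFun (Fin.last n)) = 0) :
    (segreInclusion n).comp (tangential F) = F.comp (segreInclusion n) := by
  refine ext_toFun fun i => ?_
  induction i using Fin.lastCases with
  | last =>
    change subst _ ((Fin.snoc (fun l => X l) 0 : Fin (n + 1) → MvPowerSeries (Fin n) ℂ)
      (Fin.last n)) = subst (segreInclusion n).toFun (F.toFun (Fin.last n))
    rw [hF, Fin.snoc_last, subst_zero_right (tangential F).map_zero]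
  | cast i =>
    change subst (tangential F).toFun ((Fin.snoc (fun l => X l) 0 :
      Fin (n + 1) → MvPowerSeries (Fin n) ℂ) i.castSucc) = _
    rw [Fin.snoc_castSucc, subst_X (tangential F).hasSubst, tangential_toFun]
    rfl

/-- Maps that preserve `w = 0` restrict to it functorially. -/
theorem tangential_comp_eq_id {n : ℕ} {F G : FormalMap (n + 1) (n + 1)}
    (hF : subst (segreInclusion n).toFun (F.toFun (Fin.last n)) = 0)
    (hG : subst (segreInclusion n).toFun (G.toFun (Fin.last n)) = 0)
    (hFG : F.comp G = FormalMap.id (n + 1)) :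
    (tangential F).comp (tangential G) = FormalMap.id n := by
  have h : (segreInclusion n).comp ((tangential F).comp (tangential G)) = segreInclusion n := by
    rw [← comp_assoc, segreInclusion_comp_tangential hF, comp_assoc,
      segreInclusion_comp_tangential hG, ← comp_assoc, hFG, id_comp]
  have h2 := congrArg (comp (tangentialProjection n)) h
  rwa [← comp_assoc, tangentialProjection_comp_segreInclusion, id_comp] at h2

theorem subst_segreInclusion_eq {n : ℕ} (f : MvPowerSeries (Fin (n + 1)) ℂ) :
    subst (segreInclusion n).toFun f = killCompl Fin.castSuccEmb f := by
  refine subst_eq_killCompl _ (fun i => ?_) (fun i hi => ?_) f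
  · simp [segreInclusion]
  · rw [FormalRealHypersurface.range_castSuccEmb, Set.mem_compl_iff, not_not] at hi
    rw [Set.mem_singleton_iff.1 hi]
    simp [segreInclusion]

end FormalMap

namespace FormalRealHypersurface

variable {n : ℕ} {M M' : FormalRealHypersurface (n + 1)}

open FormalMap

/-! ### The Segre variety of the origin -/

/-- The Segre variety of the origin is `w = 0`, since `Q(z, 0, 0) = 0`. -/
theorem NormalCoordinates.subst_elim_zero_eq_zero_iff {c : NormalCoordinates M} {σ : Type*}
    {Z : Fin (n + 1) → MvPowerSeries σ ℂ} (hZ : ∀ i, constantCoeff (Z i) = 0) :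
    subst (Sum.elim Z 0) (subst c.chart.complexify M.r) = 0 ↔ Z (Fin.last n) = 0 := by
  classical
  rw [NormalCoordinates.subst_eq_zero_iff hZ (by simp)]
  have hb : ∀ i, constantCoeff ((Fin.snoc (fun i : Fin n => Z i.castSucc) 0 :
      Fin (n + 1) → MvPowerSeries σ ℂ) i) = 0 := constantCoeff_snoc (fun i => hZ _) (by simp)
  have hs := hasSubst_of_constantCoeff_zero hb
  have hQ : subst (Sum.elim (fun i => Z i.castSucc) (0 : Fin (n + 1) → MvPowerSeries σ ℂ)) c.Q =
      0 := by
    have h := congrArg (subst (Fin.snoc (fun i : Fin n => Z i.castSucc) 0 :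
      Fin (n + 1) → MvPowerSeries σ ℂ)) c.normal_chi
    rw [subst_X hs, Fin.snoc_last, subst_comp_subst_apply _ hs] at h
    · rw [← h]
      congr 1
      funext i
      rcases i with i | i
      · simp [subst_X hs]
      · simp only [Sum.elim_inr, Pi.single_apply]
        split_ifs
        · simp [subst_X hs]
        · rw [subst_zero_right hb]
          rfl
    · refine hasSubst_of_constantCoeff_zero ?_
      rintro (i | i)
      · simp
      · simp only [Sum.elim_inr, Pi.single_apply]
        split_ifs <;> simp
  rw [segrePoint, hQ]
  constructor
  · intro h
    rw [h, Fin.snoc_last]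
  · intro h
    funext i
    induction i using Fin.lastCases with
    | last => rw [h, Fin.snoc_last]
    | cast i => simp

theorem chart_comp_inCoordinates (c : NormalCoordinates M) (c' : NormalCoordinates M')
    (H : FormalMap (n + 1) (n + 1)) :
    c'.chart.comp (inCoordinates c c' H) = H.comp c.chart := by
  rw [inCoordinates, ← comp_assoc, c'.chart_comp_chartInv, id_comp]

theorem exists_subst_complexify_eq_mul {H : FormalMap (n + 1) (n + 1)} (hH : SendsInto H M M') :
    ∃ A, subst H.complexify M'.r = A * M.r := by
  obtain ⟨A, hA⟩ := Ideal.mem_span_singleton.1 (hH M'.r (Ideal.mem_span_singleton_self _))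
  exact ⟨A, by rw [hA, mul_comm]⟩

theorem sendsInto_id : SendsInto (FormalMap.id (n + 1)) M M := by
  intro f hf
  have : (FormalMap.id (n + 1)).complexify = X := by
    funext i
    rcases i with i | i <;> simp [complexify, FormalMap.id]
  rwa [this, subst_self]

/-- A map between hypersurfaces respects the Segre varieties of the origin. -/
theorem subst_segreInclusion_inCoordinates {H : FormalMap (n + 1) (n + 1)}
    (hH : SendsInto H M M') (c : NormalCoordinates M) (c' : NormalCoordinates M') :
    subst (segreInclusion n).toFun ((inCoordinates c c' H).toFun (Fin.last n)) = 0 := by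
  obtain ⟨A, hA⟩ := exists_subst_complexify_eq_mul hH
  set F := inCoordinates c c' H
  have hι := (segreInclusion n).map_zero
  have hs := hasSubst_of_constantCoeff_zero
    (constantCoeff_elim (μ := Fin (n + 1)) (b := 0) hι (by simp))
  have h0 : subst (Sum.elim (segreInclusion n).toFun 0) (subst c.chart.complexify M.r) = 0 :=
    (NormalCoordinates.subst_elim_zero_eq_zero_iff hι).2 (by simp [segreInclusion])
  have h1 : subst (Sum.elim (segreInclusion n).toFun 0)
      (subst F.complexify (subst c'.chart.complexify M'.r)) = 0 := by
    rw [← subst_complexify_comp, chart_comp_inCoordinates, subst_complexify_comp, hA,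
      subst_mul (hasSubst_of_constantCoeff_zero c.chart.constantCoeff_complexify), subst_mul hs,
      h0, mul_zero]
  rw [subst_elim_zero_complexify F hι] at h1
  exact (NormalCoordinates.subst_elim_zero_eq_zero_iff (F.comp (segreInclusion n)).map_zero).1 h1

/-- The condition `r'(H(Z), 0) ≠ 0` is `G ≢ 0` stated without normal coordinates for `M'`; an
invertible change of `Z` moves it to any chart of `M`. -/
theorem subst_elim_zero_ne_zero {H : FormalMap (n + 1) (n + 1)}
    (hflat : TransversallyNonflat H M M') (c : NormalCoordinates M) :
    subst (Sum.elim (H.comp c.chart).toFun 0) M'.r ≠ 0 := by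
  obtain ⟨c₁, c₁', h⟩ := hflat
  intro h0
  refine h ?_
  set F := inCoordinates c₁ c₁' H
  have hX := constantCoeff_X (σ := Fin (n + 1)) (R := ℂ)
  have hF : subst (Sum.elim F.toFun 0) (subst c₁'.chart.complexify M'.r) =
      subst (Sum.elim (H.comp c₁.chart).toFun 0) M'.r := by
    rw [subst_elim_zero_complexify _ F.map_zero]
    congr 2
    exact congrArg toFun (chart_comp_inCoordinates c₁ c₁' H)
  refine (NormalCoordinates.subst_elim_zero_eq_zero_iff F.map_zero).1 (hF.trans ?_)
  set φ := c.chartInv.comp c₁.chart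
  have hφ : (H.comp c.chart).comp φ = H.comp c₁.chart := by
    rw [comp_assoc, ← comp_assoc c.chart, c.chart_comp_chartInv, id_comp]
  rw [← hφ]
  have h1 := congrArg (subst φ.toFun) h0
  rw [subst_zero_right φ.map_zero, subst_comp_subst_apply (hasSubst_of_constantCoeff_zero
    (constantCoeff_elim (μ := Fin (n + 1)) (b := 0) (H.comp c.chart).map_zero (by simp)))
    φ.hasSubst] at h1
  rw [← h1]
  congr 1
  funext i
  rcases i with i | i
  · rfl
  · exact (subst_zero_right φ.map_zero).symm

/-! ### Nondegeneracy -/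

/-- The conjugate of a field killing `K(z, 0)` kills `K̄(χ, 0)`; the argument for `Q` is then
applied to the hypersurface restricted to `τ = 0`. -/
theorem NormalCoordinates.IsClassC.eq_zero_of_derivAlong {c : NormalCoordinates M}
    (hc : c.IsClassC) {K : FormalMap (n + 1) (n + 1)}
    {ρ : MvPowerSeries (Fin (n + 1) ⊕ Fin (n + 1)) ℂ}
    (hK : graphEq c.Q ∣ subst K.complexify ρ) (hne : subst (Sum.elim K.toFun 0) ρ ≠ 0)
    {a : Fin n → MvPowerSeries (Fin n) ℂ} (ha : derivAlong a (K.comp (segreInclusion n)) = 0) :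
    a = 0 := by
  set η : Fin (n + 1) → MvPowerSeries (Fin n) ℂ := fun i =>
    conj (subst (segreInclusion n).toFun (K.toFun i))
  have hη : ∀ i, constantCoeff (η i) = 0 := by
    intro i
    have := (K.comp (segreInclusion n)).map_zero i
    change constantCoeff (conj ((K.comp (segreInclusion n)).toFun i)) = 0
    simp [this]
  have hconj : (fun j => conj (a j)) = 0 := by
    refine hc.eq_zero_of_Qchi (sum_mul_pderiv_eq_zero (ρ := ρ) K.map_zero hη
      c.constantCoeff_Qchi (fun i => ?_) ?_ ?_)
    · have := congrArg conj (congrFun ha i)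
      rw [derivAlong, map_sum, Pi.zero_apply, _root_.map_zero] at this
      rw [← this]
      refine Finset.sum_congr rfl fun j _ => ?_
      rw [map_mul, conj_pderiv]
      rfl
    · intro h0
      apply hne
      set b : Fin (n + 1) ⊕ Fin n → MvPowerSeries (Fin (n + 1)) ℂ := Sum.elim X 0
      have hb : ∀ i, constantCoeff (b i) = 0 := by
        rintro (i | i) <;> simp [b]
      have h1 := congrArg (subst b) h0
      rw [subst_zero_right hb, subst_comp_subst_apply (hasSubst_of_constantCoeff_zero
        (by rintro (i | i) <;> simp [K.map_zero, hη])) (hasSubst_of_constantCoeff_zero hb)] at h1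
      rw [← h1]
      congr 1
      funext i
      rcases i with i | i
      · simp only [Sum.elim_inl]
        rw [subst_rename hb]
        change K.toFun i = subst X (K.toFun i)
        rw [subst_self]
        rfl
      · simp only [Sum.elim_inr, Pi.zero_apply]
        rw [subst_rename hb]
        exact (subst_zero_of_constantCoeff_zero (hη i)).symm
    · set b : Fin (n + 1) ⊕ Fin (n + 1) → MvPowerSeries (Fin (n + 1) ⊕ Fin n) ℂ :=
        Sum.elim (fun i => X (Sum.inl i)) (Fin.snoc (fun i => X (Sum.inr i)) 0)
      have hb : ∀ i, constantCoeff (b i) = 0 :=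
        constantCoeff_elim (by simp) (constantCoeff_snoc (by simp) (by simp))
      have hs := hasSubst_of_constantCoeff_zero hb
      have h1 := map_dvd (substAlgHom (S := ℂ) hs) hK
      rw [coe_substAlgHom, subst_comp_subst_apply
        (hasSubst_of_constantCoeff_zero K.constantCoeff_complexify) hs] at h1
      have h2 : subst b (graphEq c.Q) = graphEq c.Qchi := by
        rw [graphEq, graphEq, subst_sub hs, subst_X hs, subst_rename hb]
        have h3 := c.subst_Q_snoc_zero
          (z := fun i => (X (Sum.inl i.castSucc) : MvPowerSeries (Fin (n + 1) ⊕ Fin n) ℂ))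
          (χ := fun i => X (Sum.inr i)) (by simp) (by simp)
        rw [rename_eq_subst]
        congr 1
        refine Eq.trans ?_ (h3.trans ?_)
        · congr 1
          funext i
          rcases i with i | i <;> rfl
        · congr 1
          funext i
          rcases i with i | i <;> rfl
      rw [h2] at h1
      refine h1.trans (dvd_of_eq ?_)
      congr 1
      funext i
      rcases i with i | i
      · change subst b (rename Sum.inl (K.toFun i)) = _
        rw [subst_rename hb, Sum.elim_inl, rename_eq_subst]
        rfl
      · change subst b (rename Sum.inr (conj (K.toFun i))) = _
        rw [subst_rename hb, Sum.elim_inr]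
        simp only [η]
        rw [map_subst (segreInclusion n).hasSubst, rename_subst]
        · congr 1
          funext j
          induction j using Fin.lastCases with
          | last => simp [b, segreInclusion]
          | cast j => simp [b, segreInclusion]
        · intro j
          simp [(segreInclusion n).map_zero]
  funext j
  exact conj_eq_zero.1 (congrFun hconj j)

/-! ### The main results -/

theorem NormalCoordinates.graphEq_dvd (c : NormalCoordinates M) {H : FormalMap (n + 1) (n + 1)}
    (hH : SendsInto H M M') : graphEq c.Q ∣ subst (H.comp c.chart).complexify M'.r := by
  obtain ⟨A, hA⟩ := exists_subst_complexify_eq_mul hH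
  rw [subst_complexify_comp, hA,
    subst_mul (hasSubst_of_constantCoeff_zero c.chart.constantCoeff_complexify)]
  exact c.associated_graphEq.symm.dvd.mul_left _

theorem NormalCoordinates.IsClassC.notTotallyDegenerate {c₀ : NormalCoordinates M}
    (hc : c₀.IsClassC) {H : FormalMap (n + 1) (n + 1)} (hH : SendsInto H M M')
    (hflat : TransversallyNonflat H M M') : NotTotallyDegenerate H M M' := by
  intro c c'
  set F := inCoordinates c c' H
  refine rank_eq_of_forall_mulVec_eq_zero fun a ha => ?_
  have hFlast := subst_segreInclusion_inCoordinates hH c c'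
  -- A kernel vector of `∂F/∂z(z, 0)` kills the whole restricted map, because the last component
  -- vanishes on `w = 0`.
  have hFa : derivAlong a (F.comp (segreInclusion n)) = 0 := by
    funext i
    induction i using Fin.lastCases with
    | last =>
      refine Finset.sum_eq_zero fun j _ => ?_
      change a j * pderiv ℂ j (subst (segreInclusion n).toFun (F.toFun (Fin.last n))) = 0
      rw [hFlast, _root_.map_zero, mul_zero]
    | cast i =>
      refine Eq.trans ?_ (congrFun ha i)
      refine Finset.sum_congr rfl fun j _ => ?_
      rw [mul_comm]
      congr 1
      change pderiv ℂ j (subst (segreInclusion n).toFun (F.toFun i.castSucc)) =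
        subst (segreInclusion n).toFun (pderiv ℂ j.castSucc (F.toFun i.castSucc))
      rw [subst_segreInclusion_eq, subst_segreInclusion_eq, ← killCompl_pderiv]
      rfl
  set φ := inCoordinates c c₀ (FormalMap.id (n + 1))
  set ψ := inCoordinates c₀ c (FormalMap.id (n + 1))
  have hφ := subst_segreInclusion_inCoordinates sendsInto_id c c₀
  have hψ := subst_segreInclusion_inCoordinates sendsInto_id c₀ c
  have hφψ : ∀ c c₀ : NormalCoordinates M, (inCoordinates c c₀ (FormalMap.id (n + 1))).comp
      (inCoordinates c₀ c (FormalMap.id (n + 1))) = FormalMap.id (n + 1) := by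
    intro c c₀
    conv_lhs => rw [inCoordinates]
    rw [comp_assoc, comp_assoc, chart_comp_inCoordinates, id_comp, id_comp,
      c₀.chartInv_comp_chart]
  -- The coordinates `c` are arbitrary, whereas the class `𝒞` is witnessed in `c₀`; the transition
  -- map restricted to `w = 0` carries the field over.
  refine eq_zero_of_derivAlong_comp (G := (H.comp c₀.chart).comp (segreInclusion n))
    (φ := tangential φ) (ψ := tangential ψ) (tangential_comp_eq_id hφ hψ (hφψ c c₀))
    (tangential_comp_eq_id hψ hφ (hφψ c₀ c))
    (fun b hb => hc.eq_zero_of_derivAlong (c₀.graphEq_dvd hH)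
      (subst_elim_zero_ne_zero hflat c₀) hb) ?_
  have h1 : ((H.comp c₀.chart).comp (segreInclusion n)).comp (tangential φ) =
      c'.chart.comp (F.comp (segreInclusion n)) := by
    rw [comp_assoc, segreInclusion_comp_tangential hφ, ← comp_assoc, comp_assoc H,
      chart_comp_inCoordinates, id_comp, ← comp_assoc, chart_comp_inCoordinates]
  rw [h1]
  exact derivAlong_comp_eq_zero hFa _

/-- Differentiating the identity at the origin gives `∂r'(0) ∘ dH = A(0) ∂r(0)`, which is nonzero,
so the image of `dH` is not contained in the hyperplane `T₀^{1,0} M'`. -/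
theorem crTransversal_of_constantCoeff_ne_zero {H : FormalMap (n + 1) (n + 1)}
    {A : MvPowerSeries (Fin (n + 1) ⊕ Fin (n + 1)) ℂ}
    (hA : subst H.complexify M'.r = A * M.r) (hA0 : constantCoeff A ≠ 0) :
    CRTransversal H M' := by
  classical
  obtain ⟨j, hj⟩ := M.gradient_ne_zero
  set L : (Fin (n + 1) → ℂ) →ₗ[ℂ] ℂ := ∑ i, constantCoeff (pderiv ℂ (Sum.inl i) M'.r) •
    (LinearMap.proj i : (Fin (n + 1) → ℂ) →ₗ[ℂ] ℂ)
  set v := H.differentialMatrix.mulVecLin (Pi.single j 1)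
  have hv : L v = constantCoeff A * constantCoeff (pderiv ℂ (Sum.inl j) M.r) := by
    have h := congrArg (fun f => constantCoeff (pderiv ℂ (Sum.inl j) f)) hA
    simp only [pderiv_subst H.constantCoeff_complexify, map_sum, map_mul,
      constantCoeff_subst_of_zero H.constantCoeff_complexify, Derivation.leibniz, smul_eq_mul,
      map_add, M.zero_mem, zero_mul, add_zero, Fintype.sum_sum_type] at h
    rw [← h, Finset.sum_eq_zero (s := Finset.univ) (f := fun i : Fin (n + 1) =>
      constantCoeff (pderiv ℂ (Sum.inr i) M'.r) *
        constantCoeff (pderiv ℂ (Sum.inl j) (H.complexify (Sum.inr i)))), add_zero]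
    · simp only [L, v, LinearMap.sum_apply, LinearMap.smul_apply, LinearMap.proj_apply, smul_eq_mul]
      refine Finset.sum_congr rfl fun i _ => ?_
      congr 1
      have h2 : pderiv ℂ (Sum.inl j) (H.complexify (Sum.inl i)) =
          rename Sum.inl (pderiv ℂ j (H.toFun i)) := pderiv_rename Sum.inl_injective _ _
      rw [h2, constantCoeff_rename]
      simp [differentialMatrix]
    · intro i _
      have h2 : pderiv ℂ (Sum.inl j) (H.complexify (Sum.inr i)) = 0 :=
        pderiv_rename_of_notMem (by simp) _
      rw [h2, _root_.map_zero, mul_zero]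
  have hv0 : L v ≠ 0 := by
    rw [hv]
    exact mul_ne_zero hA0 hj
  rw [CRTransversal, eq_top_iff]
  intro x _
  have hx : x = (x - (L x / L v) • v) + (L x / L v) • v := by simp
  rw [hx]
  refine Submodule.add_mem_sup ?_ (Submodule.smul_mem _ _ ⟨_, rfl⟩)
  change L (x - (L x / L v) • v) = 0
  rw [map_sub, map_smul, smul_eq_mul, div_mul_cancel₀ _ hv0, sub_self]

theorem NormalCoordinates.IsClassC.crTransversal {c : NormalCoordinates M}
    (hc : c.IsClassC) (hn : 1 ≤ n) {H : FormalMap (n + 1) (n + 1)} (hH : SendsInto H M M')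
    (hflat : TransversallyNonflat H M M') : CRTransversal H M' := by
  obtain ⟨A, hA⟩ := exists_subst_complexify_eq_mul hH
  refine crTransversal_of_constantCoeff_ne_zero hA ?_
  -- Both `r` and `r'` are real and `r` is not a zero divisor, so the factor is real too.
  have hAreal : involution A = A := by
    have h := congrArg involution hA
    rw [H.involution_subst_complexify, M'.invariant, involution_mul, M.invariant, hA] at h
    exact (mul_right_cancel₀ M.r_ne_zero h).symm
  have hK : subst (H.comp c.chart).complexify M'.r =
      subst c.chart.complexify A * subst c.chart.complexify M.r := by
    rw [subst_complexify_comp, hA,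
      subst_mul (hasSubst_of_constantCoeff_zero c.chart.constantCoeff_complexify)]
  obtain ⟨y, u, hu, h⟩ := NormalCoordinates.exists_subst_graphMap_mul_eq hK
  have h0 := hc.constantCoeff_ne_zero hn
    (by rw [FormalMap.involution_subst_complexify, hAreal])
    (hc.conjJacobian_ne_zero (c.graphEq_dvd hH) (subst_elim_zero_ne_zero hflat c)) hu h
  rwa [constantCoeff_subst_of_zero c.chart.constantCoeff_complexify] at h0

end FormalRealHypersurface

end FormalCR

end

theorem theorem2p2 (n : ℕ) (hn : 1 ≤ n) (M M' : FormalCR.FormalRealHypersurface (n + 1))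
    (hM : M.InClassC) (H : FormalCR.FormalMap (n + 1) (n + 1))
    (hH : FormalCR.SendsInto H M M') (hflat : FormalCR.TransversallyNonflat H M M') :
    FormalCR.NotTotallyDegenerate H M M' ∧ FormalCR.CRTransversal H M' := by
  obtain ⟨c, k₀, hc⟩ := hM
  have hc' : c.IsClassC := ⟨k₀, hc k₀ le_rfl⟩
  exact ⟨hc'.notTotallyDegenerate hH hflat, hc'.crTransversal hn hH hflat⟩
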